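/- Let $d,k,n$ be natural numbers with $n\ge 2k$. Irreps of symmetric groups. For $\mu\vdash l$ let $\varphi^\mu$ be the irreducible representation of $S(l)$ labelled by $\mu$, given by unitary matrices in a Young–Yamanouchi basis: rows and columns are indexed by the paths $i_\mu=(\mu=\mu_l\to\mu_{l-1}\to\cdots\to\mu_0=\emptyset)$ in Young's lattice (one box is removed at each step), and the matrices are chosen so that for every $\mu\vdash l+1$ the restriction of $\varphi^\mu$ to $S(l)$ is the block-diagonal matrix $\bigoplus_{\alpha}\varphi^\alpha$ over the diagrams $\alpha\vdash l$ contained in $\mu$, the block $\alpha$ consisting of the indices whose path passes through $\alpha$. For $\alpha\vdash n-2k$, $\mu\vdash n-k$, a path $r_{\mu/\alpha}$ from $\mu$ to $\alpha$ and an index $l_\alpha$ compose to an index $(r_{\mu/\alpha},l_\alpha)$ of $\mu$. Fix, for each $\alpha$, an index $1_\alpha$. Let $d_\mu=\dim\varphi^\mu$ and let $m_\mu$ be the multiplicity of $\varphi^\mu$, $\mu\vdash l$, in the representation $\tau\mapsto V_\tau$ of $S(l)$ on $(\mathbb C^d)^{\otimes l}$ permuting the tensor factors. Put $$E^\mu_{ij}=\frac{d_\mu}{l!}\sum_{\tau\in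 S(l)}\varphi^\mu_{ji}(\tau^{-1})\,V_\tau .$$ Operators. Let $t_s$ be the partial transposition on subsystem $s$ in the standard basis, let $V_{r,s}$ be the swap of subsystems $r,s$ of $(\mathbb C^d)^{\otimes n}$, and $$V^{(k)}=V^{t_n}_{n-2k+1,n}\,V^{t_{n-1}}_{n-2k+2,n-1}\cdots V^{t_{n-k+1}}_{n-k,n-k+1}.$$ Let $\mathcal A$ be the algebra generated by all $V_\sigma$, $\sigma\in S(n)$, partially transposed on the last $k$ subsystems, and let $\mathcal M$ be the two-sided ideal of $\mathcal A$ generated by $V^{(k)}$. For $\alpha\vdash n-2k$, diagrams $\mu,\nu\vdash n-k$ with at most $d$ rows, paths $r_{\mu/\alpha},r_{\nu/\alpha}$ and indices $i_\mu,j_\nu$ define $$F^{r_{\mu/\alpha}\,r_{\nu/\alpha}}_{i_\mu\ j_\nu}=\frac{m_\alpha}{\sqrt{m_\mu m_\nu}}\;\bigl(E^{\mu}_{i_\mu,(r_{\mu/\alpha},1_\alpha)}\otimes\mathbf 1\bigr)\,V^{(k)}\,\bigl(E^{\nu}_{(r_{\nu/\alpha},1_\alpha),j_\nu}\otimes\mathbf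 1\bigr),$$ where $\mathbf 1$ is the identity on the last $k$ subsystems. Theorem. The ideal $\mathcal M$ is contained in the commutant of $\{U^{\otimes(n-k)}\otimes\overline U^{\otimes k}: U\in\mathcal U(d)\}$, and the family of all operators $F^{r_{\mu/\alpha}\,r_{\nu/\alpha}}_{i_\mu\ j_\nu}$ is a basis of the vector space $\mathcal M$. It satisfies the composition rule $$F^{r_{\mu/\alpha}\,r_{\nu/\alpha}}_{i_\mu\ j_\nu}\,F^{r_{\mu'/\beta}\,r_{\nu'/\beta}}_{k_{\mu'}\ l_{\nu'}}=\delta^{r_{\nu/\alpha}\,r_{\mu'/\beta}}\,\delta_{j_\nu k_{\mu'}}\,F^{r_{\mu/\alpha}\,r_{\nu'/\alpha}}_{i_\mu\ l_{\nu'}}$$ (where $\delta^{r_{\nu/\alpha}\,r_{\mu'/\beta}}=0$ unless the two paths, with both their end points, coincide), and it is orthonormal for the trace inner product normalized by the multiplicity: $\operatorname{tr}\bigl(F^{r_{\mu/\alpha}r_{\nu/\alpha}}_{i_\mu\ j_\nu}{}^{\dagger}\,F^{r_{\mu'/\beta}r_{\nu'/\beta}}_{k_{\mu'}\ l_{\nu'}}\bigr)$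 equals $m_\alpha$ if the two operators have the same labels and $0$ otherwise. -/

import Mathlib

noncomputable section

namespace WalledBrauer

/-! ### Young diagrams, paths in Young's lattice -/

/-- Young diagrams with `n` boxes, i.e. `μ ⊢ n`. -/
abbrev Shape (n : ℕ) : Type := {μ : YoungDiagram // μ.card = n}

instance decEqYoungDiagram : DecidableEq YoungDiagram := Classical.decEq _

/-- The diagrams contained in `μ`, with one box less, i.e. `α ∈ μ`. -/
abbrev Below {n : ℕ} (μ : Shape (n + 1)) : Type := {α : Shape n // α.1 ≤ μ.1}

theorem finite_below {n : ℕ} (μ : Shape (n + 1)) : Finite (Below μ) := by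
  refine Finite.of_injective
    (fun α : Below μ => (⟨α.1.1.cells, ?_⟩ : {s // s ∈ μ.1.cells.powerset})) ?_
  · exact Finset.mem_powerset.2 (YoungDiagram.cells_subset_iff.2 α.2)
  · intro α β h
    apply Subtype.ext
    apply Subtype.ext
    exact YoungDiagram.ext (congrArg Subtype.val h)

instance fintypeBelow {n : ℕ} (μ : Shape (n + 1)) : Fintype (Below μ) :=
  haveI := finite_below μ
  Fintype.ofFinite _

/-- The basis indices `i_μ` of the irrep `μ ⊢ n`: paths in Young's lattice
`μ = μ_n → μ_{n-1} → ⋯ → μ_0 = ∅` in which one box is removed at every step (equivalently, standard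
Young tableaux of shape `μ`; the last steps, from the one-box diagram on, carry no information).
An index of `μ ⊢ n + 1` is a pair of a diagram `α ∈ μ` and an index of `α`. -/
def Idx : (n : ℕ) → Shape n → Type
  | 0, _ => Unit
  | n + 1, μ => Σ α : Below μ, Idx n α.1

/-- There are finitely many basis indices. -/
@[reducible] def fintypeIdxAux : (n : ℕ) → (μ : Shape n) → Fintype (Idx n μ)
  | 0, _ => inferInstanceAs (Fintype Unit)
  | n + 1, μ =>
    haveI : ∀ α : Below μ, Fintype (Idx n α.1) := fun α => fintypeIdxAux n α.1
    inferInstanceAs (Fintype (Σ α : Below μ, Idx n α.1))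

instance fintypeIdx (n : ℕ) (μ : Shape n) : Fintype (Idx n μ) := fintypeIdxAux n μ

instance decEqIdx (n : ℕ) (μ : Shape n) : DecidableEq (Idx n μ) := Classical.decEq _

/-- Paths `r_{μ/α}` in Young's lattice, from `μ ⊢ m + k` down to `α ⊢ m`, removing one box at every
step. -/
def Path {m : ℕ} (α : Shape m) : (k : ℕ) → Shape (m + k) → Type
  | 0, μ => PLift (μ = α)
  | k + 1, μ => Σ β : Below (n := m + k) μ, Path α k β.1

/-- The basis index `i_μ = (r_{μ/α}, l_α)` composed of a path `r_{μ/α}` and a basis index `l_α`. -/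
def Path.append {m : ℕ} {α : Shape m} :
    {k : ℕ} → {μ : Shape (m + k)} → Path α k μ → Idx m α → Idx (m + k) μ
  | 0, _, r, l => r.down.symm ▸ l
  | _ + 1, _, r, l => ⟨r.1, Path.append r.2 l⟩

/-! ### Irreducible matrix representations of the symmetric groups in PRIR form -/

/-- The embedding `S(n) ⊆ S(n + j)`, `S(n)` acting on the first `n` points. -/
def extendPerm (n j : ℕ) (σ : Equiv.Perm (Fin n)) : Equiv.Perm (Fin (n + j)) :=
  finSumFinEquiv.permCongr (Equiv.Perm.sumCongr σ 1)

/-- The representation on `ℂ^ι` given by a homomorphism into unitary matrices. -/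
def matrixRep {G ι : Type*} [Group G] [Fintype ι] [DecidableEq ι]
    (φ : G →* Matrix.unitaryGroup ι ℂ) : Representation ℂ G (ι → ℂ) where
  toFun g := Matrix.toLin' (φ g : Matrix ι ι ℂ)
  map_one' := by simp; rfl
  map_mul' g h := by simp [Matrix.toLin'_mul]; rfl

/-- The Young symmetrizer `∑_p ∑_q sgn(q) p q` of a tableau `T` of shape `μ`, where `p` runs over the
permutations preserving the rows of `T`, and `q` over those preserving its columns, evaluated in a
matrix representation `φ` of `S(n)`. -/
def youngSymmetrizer {n : ℕ} {μ : Shape n} {ι : Type*} [Fintype ι] [DecidableEq ι]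
    (T : μ.1.cells ≃ Fin n) (φ : Equiv.Perm (Fin n) →* Matrix.unitaryGroup ι ℂ) : Matrix ι ι ℂ :=
  open Classical in
  ∑ p : {p : Equiv.Perm (Fin n) // ∀ c : μ.1.cells, (T.symm (p (T c))).1.1 = c.1.1},
    ∑ q : {q : Equiv.Perm (Fin n) // ∀ c : μ.1.cells, (T.symm (q (T c))).1.2 = c.1.2},
      ((Equiv.Perm.sign q.1 : ℤ) : ℂ) • (φ (p.1 * q.1) : Matrix ι ι ℂ)

/-- `φ` is a system of irreducible unitary matrix representations `φ^μ` of the symmetric groups, one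
for every Young diagram `μ`, in PRIR form (a Young-Yamanouchi system): the rows and columns of `φ^μ`
are indexed by the paths `i_μ`, and the restriction of `φ^μ`, `μ ⊢ n + 1`, to `S(n)` is the block
diagonal matrix `⨁_{α ∈ μ} φ^α`.  The irrep `φ^μ` is the one labelled by the diagram `μ` (the Specht
module), that is, the irrep which is not annihilated by the Young symmetrizer of shape `μ`. -/
structure IsPRIR
    (φ : (n : ℕ) → (μ : Shape n) → Equiv.Perm (Fin n) →* Matrix.unitaryGroup (Idx n μ) ℂ) :
    Prop where
  irreducible : ∀ (n : ℕ) (μ : Shape n), (matrixRep (φ n μ)).IsIrreducible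
  label : ∀ (n : ℕ) (μ : Shape n), ∃ T : μ.1.cells ≃ Fin n, youngSymmetrizer T (φ n μ) ≠ 0
  block_diag : ∀ (n : ℕ) (μ : Shape (n + 1)) (α : Below μ) (i j : Idx n α.1)
    (σ : Equiv.Perm (Fin n)),
    (φ (n + 1) μ (extendPerm n 1 σ) : Matrix (Idx (n + 1) μ) (Idx (n + 1) μ) ℂ) ⟨α, i⟩ ⟨α, j⟩ =
      (φ n α.1 σ : Matrix (Idx n α.1) (Idx n α.1) ℂ) i j
  block_off : ∀ (n : ℕ) (μ : Shape (n + 1)) (α β : Below μ) (i : Idx n α.1) (j : Idx n β.1)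
    (σ : Equiv.Perm (Fin n)), α ≠ β →
    (φ (n + 1) μ (extendPerm n 1 σ) : Matrix (Idx (n + 1) μ) (Idx (n + 1) μ) ℂ) ⟨α, i⟩ ⟨β, j⟩ = 0

/-! ### Operators on `(ℂ^d)^{⊗n}`, as matrices in the standard product basis -/

/-- Operators on `(ℂ^d)^{⊗n}`; the standard product basis is indexed by `Fin n → Fin d`. -/
abbrev Op (d n : ℕ) : Type := Matrix (Fin n → Fin d) (Fin n → Fin d) ℂ

/-- The permutation operator `V_σ |x_1 … x_n⟩ = |x_{σ⁻¹(1)} … x_{σ⁻¹(n)}⟩`. -/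
def permOp (d : ℕ) {n : ℕ} (σ : Equiv.Perm (Fin n)) : Op d n :=
  Matrix.of fun x y => if x = y ∘ ⇑σ⁻¹ then 1 else 0

/-- The representation `σ ↦ V_σ` of `S(n)` on `(ℂ^d)^{⊗n}`. -/
def permRep (d n : ℕ) : Representation ℂ (Equiv.Perm (Fin n)) ((Fin n → Fin d) → ℂ) where
  toFun σ := Matrix.toLin' (permOp d σ)
  map_one' := by
    rw [show permOp d (1 : Equiv.Perm (Fin n)) = 1 by
      ext x y; simp [permOp, Matrix.one_apply], Matrix.toLin'_one]
    rfl
  map_mul' σ τ := by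
    rw [show permOp d (σ * τ) = permOp d σ * permOp d τ by
      ext x y
      simp only [permOp, Matrix.mul_apply, Matrix.of_apply, mul_ite, mul_one, mul_zero,
        Finset.sum_ite_eq', Finset.mem_univ, if_true, mul_inv_rev, Equiv.Perm.coe_mul,
        Function.comp_assoc], Matrix.toLin'_mul]
    rfl

/-- The partial transposition, in the standard basis, on the subsystems belonging to `s`. -/
def partialTranspose {d n : ℕ} (s : Finset (Fin n)) (X : Op d n) : Op d n :=
  Matrix.of fun x y =>
    X (fun i => if i ∈ s then y i else x i) (fun i => if i ∈ s then x i else y i)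

/-- `X ⊗ 1`, for an operator `X` on the first `n` out of `n + j` subsystems. -/
def tensorOne {d n : ℕ} (j : ℕ) (X : Op d n) : Op d (n + j) :=
  Matrix.of fun x y =>
    X (x ∘ Fin.castAdd j) (y ∘ Fin.castAdd j) *
      if x ∘ Fin.natAdd n = y ∘ Fin.natAdd n then 1 else 0

/-- `U^{⊗(n-k)} ⊗ Ū^{⊗k}`, with `N = n - k`. -/
def mixedTensorPower {d : ℕ} (N k : ℕ) (U : Matrix (Fin d) (Fin d) ℂ) : Op d (N + k) :=
  Matrix.of fun x y =>
    (∏ i : Fin N, U (x (Fin.castAdd k i)) (y (Fin.castAdd k i))) *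
      ∏ i : Fin k, star (U (x (Fin.natAdd N i)) (y (Fin.natAdd N i)))

/-- The commutant of the operators `U^{⊗(n-k)} ⊗ Ū^{⊗k}`, `U` unitary. -/
def mixedCommutant (d N k : ℕ) : Subalgebra ℂ (Op d (N + k)) :=
  Subalgebra.centralizer ℂ
    {X | ∃ U ∈ Matrix.unitaryGroup (Fin d) ℂ, X = mixedTensorPower N k U}

/-- The last `k` of `N + k` subsystems. -/
def lastSystems (N k : ℕ) : Finset (Fin (N + k)) :=
  Finset.univ.image (Fin.natAdd N : Fin k → Fin (N + k))

/-- The algebra `A_n^{(k)}(d)`, `n = N + k`, generated by the permutation operators on `n` subsystems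
partially transposed on the last `k` of them. -/
def ptAlgebra (d N k : ℕ) : Subalgebra ℂ (Op d (N + k)) :=
  Algebra.adjoin ℂ
    (Set.range fun σ : Equiv.Perm (Fin (N + k)) => partialTranspose (lastSystems N k) (permOp d σ))

/-- The operator `V^{(k)} = V^{t_n}_{n-2k+1,n} V^{t_{n-1}}_{n-2k+2,n-1} ⋯ V^{t_{n-k+1}}_{n-k,n-k+1}`
on `n = m + k + k` subsystems. In zero-based numbering the `j`-th factor pairs the subsystem `m + j`
with the subsystem `n - 1 - j`. -/
def contractionOp (d m k : ℕ) : Op d (m + k + k) :=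
  (List.ofFn fun j : Fin k =>
    partialTranspose {Fin.natAdd (m + k) j.rev}
      (permOp d (Equiv.swap (Fin.castAdd k (Fin.natAdd m j)) (Fin.natAdd (m + k) j.rev)))).prod

/-- The ideal `M`: the two-sided ideal of the algebra `A_n^{(k)}(d)` generated by `V^{(k)}`. -/
def idealM (d m k : ℕ) : Submodule ℂ (Op d (m + k + k)) :=
  Submodule.span ℂ
    {X | ∃ A ∈ ptAlgebra d (m + k) k, ∃ B ∈ ptAlgebra d (m + k) k, X = A * contractionOp d m k * B}

/-! ### The operators `E` and `F` -/

section Basis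

variable (φ : (n : ℕ) → (μ : Shape n) → Equiv.Perm (Fin n) →* Matrix.unitaryGroup (Idx n μ) ℂ)

/-- The multiplicity `m_μ` of the irrep `φ^μ` of `S(n)` in `(ℂ^d)^{⊗n}`. -/
def mult (d : ℕ) {n : ℕ} (μ : Shape n) : ℕ :=
  Module.finrank ℂ (Representation.IntertwiningMap (matrixRep (φ n μ)) (permRep d n))

/-- `E^μ_{ij} = (d_μ / n!) ∑_{τ ∈ S(n)} φ^μ_{ji}(τ⁻¹) V_τ`. -/
def opE (d : ℕ) {n : ℕ} (μ : Shape n) (i j : Idx n μ) : Op d n :=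
  ((Fintype.card (Idx n μ) : ℂ) / (n.factorial : ℂ)) •
    ∑ τ : Equiv.Perm (Fin n), (φ n μ τ⁻¹ : Matrix (Idx n μ) (Idx n μ) ℂ) j i • permOp d τ

/-- For `α ⊢ n - 2k = m`, the triples `(μ, r_{μ/α}, i_μ)` of a diagram `μ ⊢ n - k = m + k` with at
most `d` rows, a path from `μ` to `α`, and a basis index of `μ`. -/
abbrev Label (d : ℕ) {m : ℕ} (k : ℕ) (α : Shape m) : Type :=
  Σ μ : {μ : Shape (m + k) // μ.1.colLen 0 ≤ d}, Path α k μ.1 × Idx (m + k) μ.1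

variable (one : (m : ℕ) → (α : Shape m) → Idx m α)

/-- `F^{r_{μ/α} r_{ν/α}}_{i_μ j_ν} =
(m_α / √(m_μ m_ν)) E^{μ}_{i_μ (r_{μ/α}, 1_α)} V^{(k)} E^{ν}_{(r_{ν/α}, 1_α) j_ν}` where
`a = (μ, r_{μ/α}, i_μ)` and `b = (ν, r_{ν/α}, j_ν)`, and `1_α` is a fixed basis index of `α`. -/
def opF (d : ℕ) {m k : ℕ} (α : Shape m) (a b : Label d k α) : Op d (m + k + k) :=
  ((mult φ d α / √(mult φ d a.1.1 * mult φ d b.1.1) : ℝ) : ℂ) •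
    (tensorOne k (opE φ d a.1.1 a.2.2 (a.2.1.append (one m α))) * contractionOp d m k *
      tensorOne k (opE φ d b.1.1 (b.2.1.append (one m α)) b.2.2))

end Basis

end WalledBrauer

end

open WalledBrauer

/-! The ideal is controlled by the factorization `contractionOp_eq`: V^{(k)} = arcs · arcs†, where
arcs sends |u⟩ to the sum over c of |u c c'⟩, with c' the reversal of c. It has three consequences.
Closing the arcs around X ⊗ 1 traces out the last k of the m + k subsystems of X, so V^{(k)} (X ⊗ 1)
V^{(k)} = (tr_k X ⊗ 1 ⊗ 1) V^{(k)}. Operators on the first m subsystems commute with V^{(k)}. On the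
arcs every element of the partially transposed algebra acts as T ⊗ 1 with T in the span of the
permutations of m + k subsystems (`exists_mul_arcs_eq`), so `idealM` is the span of the operators (T
⊗ 1) V^{(k)} (T' ⊗ 1).

Expanding T and T' in the matrix units E^μ and using that the basis is adapted to restriction,
E^μ_{i,(r,l)} = E^μ_{i,(r,1)} (E^α_{1,l} ⊗ 1). The factor E^α_{1,l} passes through V^{(k)} and is
absorbed or annihilated on the other side; only multiples of the F remain, so they span.

For the composition rule, the partial trace of E^μ_{(r,l),(s,l')} is δ_{rs} (m_μ/m_α) E^α_{l,l'}
when both paths end at α, and 0 when the end points differ (`IsPRIR.partialTrace_opE`,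
`IsPRIR.partialTrace_opE_of_ne`). The square roots in F are chosen to cancel m_μ/m_α. Thus the F are
matrix units with tr F_{aa} = m_α, and orthogonality and linear independence follow.

The representation theory needed is that the matrix units span the whole group algebra and that E^μ
acts nontrivially on tensors exactly when μ has at most d rows. Young symmetrizers separate the
labels, so the φ^μ are inequivalent. There are at least as many diagrams as conjugacy classes, so
the characters span the class functions, and the identity is a combination of diagonal matrix units.
Evaluating Young symmetrizers on tensors settles the condition on rows. -/

noncomputable section

namespace WalledBrauer

/-! ### Schur orthogonality for unitary matrix representations -/

section Schur

variable {G ι κ : Type*} [Group G] [Fintype ι] [DecidableEq ι] [Fintype κ] [DecidableEq κ]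
  (φ : G →* Matrix.unitaryGroup ι ℂ) (ψ : G →* Matrix.unitaryGroup κ ℂ)

/-- The extension of a unitary matrix representation to the group algebra. -/
def groupAlgHom : MonoidAlgebra ℂ G →ₐ[ℂ] Matrix ι ι ℂ :=
  MonoidAlgebra.lift ℂ _ _ ((Matrix.unitaryGroup ι ℂ).subtype.comp φ)

theorem groupAlgHom_single (g : G) (c : ℂ) :
    groupAlgHom φ (MonoidAlgebra.single g c) = c • (φ g : Matrix ι ι ℂ) := by
  simp [groupAlgHom]

theorem coe_inv_unitary (g : G) :
    (φ g⁻¹ : Matrix ι ι ℂ) = (φ g : Matrix ι ι ℂ).conjTranspose := by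
  rw [map_inv]; rfl

theorem coe_mul_unitary (g h : G) :
    (φ (g * h) : Matrix ι ι ℂ) = (φ g : Matrix ι ι ℂ) * (φ h : Matrix ι ι ℂ) := by
  rw [map_mul]; rfl

theorem matrixRep_apply (g : G) (v : ι → ℂ) : matrixRep φ g v = (φ g : Matrix ι ι ℂ).mulVec v := by
  simp [matrixRep]

/-- A matrix intertwining two representations, as an intertwining map. -/
def intertwiningOfMatrix (Z : Matrix ι κ ℂ)
    (hZ : ∀ g, (φ g : Matrix ι ι ℂ) * Z = Z * (ψ g : Matrix κ κ ℂ)) :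
    Representation.IntertwiningMap (matrixRep ψ) (matrixRep φ) :=
  (Matrix.toLin' Z).intertwiningMap_of_isIntertwiningMap _ _ (fun g v => by
    simp [matrixRep_apply, Matrix.mulVec_mulVec, hZ])

theorem intertwiningOfMatrix_apply (Z : Matrix ι κ ℂ)
    (hZ : ∀ g, (φ g : Matrix ι ι ℂ) * Z = Z * (ψ g : Matrix κ κ ℂ)) (v : κ → ℂ) :
    intertwiningOfMatrix φ ψ Z hZ v = Z.mulVec v := by
  simp [intertwiningOfMatrix]

/-- Schur's lemma over the algebraically closed field ℂ, in matrix form. -/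
theorem matrix_eq_smul_one_of_commute (hφ : (matrixRep φ).IsIrreducible) (Z : Matrix ι ι ℂ)
    (hZ : ∀ g, (φ g : Matrix ι ι ℂ) * Z = Z * (φ g : Matrix ι ι ℂ)) : ∃ c : ℂ, Z = c • 1 := by
  obtain ⟨c, hc⟩ := (Representation.IsIrreducible.algebraMap_intertwiningMap_bijective_of_isAlgClosed
    (ρ := matrixRep φ)).2 (intertwiningOfMatrix φ φ Z hZ)
  refine ⟨c, ?_⟩
  apply Matrix.toLin'.injective
  ext1 i
  ext1
  have := congrArg (fun f => f (Pi.single i 1)) hc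
  simp only [intertwiningOfMatrix_apply] at this
  simp [← this, Algebra.algebraMap_eq_smul_one]

theorem mulVec_bijective_of_intertwines (hφ : (matrixRep φ).IsIrreducible)
    (hψ : (matrixRep ψ).IsIrreducible) (Z : Matrix ι κ ℂ) (h0 : Z ≠ 0)
    (hZ : ∀ g, (φ g : Matrix ι ι ℂ) * Z = Z * (ψ g : Matrix κ κ ℂ)) :
    Function.Bijective Z.mulVec := by
  rcases Representation.IsIrreducible.bijective_or_eq_zero (intertwiningOfMatrix φ ψ Z hZ)
    with h | h
  · rwa [show Z.mulVec = intertwiningOfMatrix φ ψ Z hZ from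
      funext fun v => (intertwiningOfMatrix_apply φ ψ Z hZ v).symm]
  · exfalso
    apply h0
    apply Matrix.toLin'.injective
    ext1 i
    ext1
    have := congrArg (fun f => f (Pi.single i 1)) h
    simp only [intertwiningOfMatrix_apply] at this
    simp [this]

theorem groupAlgHom_mul_of_intertwines (Z : Matrix ι κ ℂ)
    (hZ : ∀ g, (φ g : Matrix ι ι ℂ) * Z = Z * (ψ g : Matrix κ κ ℂ)) (x : MonoidAlgebra ℂ G) :
    groupAlgHom φ x * Z = Z * groupAlgHom ψ x := by
  induction x using MonoidAlgebra.induction_linear with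
  | zero => simp
  | add x y hx hy => simp [Matrix.add_mul, Matrix.mul_add, hx, hy]
  | single g c => simp [groupAlgHom_single, hZ]

/-- A nonzero intertwiner of irreducibles is invertible. This carries the nonvanishing of a Young
symmetrizer from one irrep to an equivalent one. -/
theorem groupAlgHom_ne_zero_of_intertwines (hφ : (matrixRep φ).IsIrreducible)
    (hψ : (matrixRep ψ).IsIrreducible) (Z : Matrix ι κ ℂ) (h0 : Z ≠ 0)
    (hZ : ∀ g, (φ g : Matrix ι ι ℂ) * Z = Z * (ψ g : Matrix κ κ ℂ)) {x : MonoidAlgebra ℂ G}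
    (hx : groupAlgHom φ x ≠ 0) : groupAlgHom ψ x ≠ 0 := by
  intro h
  apply hx
  have h1 := groupAlgHom_mul_of_intertwines φ ψ Z hZ x
  rw [h, Matrix.mul_zero] at h1
  apply Matrix.toLin'.injective
  refine LinearMap.ext fun v => ?_
  obtain ⟨w, rfl⟩ := (mulVec_bijective_of_intertwines φ ψ hφ hψ Z h0 hZ).2 v
  simp [Matrix.mulVec_mulVec, h1]

/-- In an irreducible representation every orbit of a nonzero vector spans. -/
theorem exists_groupAlgHom_mulVec_eq (hφ : (matrixRep φ).IsIrreducible) {v : ι → ℂ} (hv : v ≠ 0)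
    (w : ι → ℂ) : ∃ x : MonoidAlgebra ℂ G, (groupAlgHom φ x).mulVec v = w := by
  let S : Subrepresentation (matrixRep φ) :=
    { toSubmodule := LinearMap.range ((LinearMap.applyₗ v ∘ₗ
        (Matrix.toLin'.toLinearMap : Matrix ι ι ℂ →ₗ[ℂ] _)) ∘ₗ (groupAlgHom φ).toLinearMap)
      apply_mem_toSubmodule := by
        rintro g _ ⟨x, rfl⟩
        refine ⟨MonoidAlgebra.single g 1 * x, ?_⟩
        simp [matrixRep_apply, groupAlgHom_single, Matrix.mulVec_mulVec] }
  have hS : S = ⊤ := by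
    rcases eq_bot_or_eq_top S with h | h
    · exfalso
      have : v ∈ S := ⟨1, by simp⟩
      rw [h] at this
      exact hv this
    · exact h
  have : w ∈ S := by rw [hS]; trivial
  obtain ⟨x, hx⟩ := this
  exact ⟨x, by simpa using hx⟩

/-- Take u and v with au ≠ 0 and bv ≠ 0; irreducibility supplies an x moving bv to u, and then axbv
≠ 0. -/
theorem exists_mul_mul_ne_zero (hφ : (matrixRep φ).IsIrreducible) {a b : MonoidAlgebra ℂ G}
    (ha : groupAlgHom φ a ≠ 0) (hb : groupAlgHom φ b ≠ 0) :
    ∃ x : MonoidAlgebra ℂ G, a * x * b ≠ 0 := by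
  by_contra! h
  have key : ∀ {M : Matrix ι ι ℂ}, M ≠ 0 → ∃ v, M.mulVec v ≠ 0 := by
    intro M hM
    by_contra! h
    exact hM (Matrix.toLin'.injective (LinearMap.ext fun v => by simp [h]))
  obtain ⟨u, hu⟩ := key ha
  obtain ⟨v, hv⟩ := key hb
  obtain ⟨x, hx⟩ := exists_groupAlgHom_mulVec_eq φ hφ hv u
  apply hu
  rw [← hx, Matrix.mulVec_mulVec, Matrix.mulVec_mulVec, ← map_mul, ← map_mul, h x]
  simp

variable [Fintype G]

/-- Averaging over the group produces an intertwiner. With X a matrix unit, its entries are the sums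
in the orthogonality relations. -/
theorem sum_conj_intertwines (X : Matrix ι κ ℂ) (h : G) :
    (φ h : Matrix ι ι ℂ) * ∑ g, (φ g⁻¹ : Matrix ι ι ℂ) * X * (ψ g : Matrix κ κ ℂ) =
      (∑ g, (φ g⁻¹ : Matrix ι ι ℂ) * X * (ψ g : Matrix κ κ ℂ)) * (ψ h : Matrix κ κ ℂ) := by
  rw [Matrix.mul_sum, Matrix.sum_mul]
  refine Fintype.sum_equiv (Equiv.mulRight h⁻¹) _ _ fun g => ?_
  simp only [Equiv.coe_mulRight, mul_inv_rev, inv_inv]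
  rw [← Matrix.mul_assoc, ← Matrix.mul_assoc, ← coe_mul_unitary,
    Matrix.mul_assoc _ _ (ψ h : Matrix κ κ ℂ), ← coe_mul_unitary]
  simp

/-- Schur orthogonality for the matrix elements of one irreducible representation. -/
theorem sum_matrixElement_mul_self (hφ : (matrixRep φ).IsIrreducible) (i j a b : ι) :
    ∑ g, (φ g⁻¹ : Matrix ι ι ℂ) j i * (φ g : Matrix ι ι ℂ) a b =
      if j = b ∧ i = a then (Fintype.card G : ℂ) / Fintype.card ι else 0 := by
  obtain ⟨c, hc⟩ := matrix_eq_smul_one_of_commute φ hφ _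
    (sum_conj_intertwines φ φ (Matrix.single i a 1))
  have hι : (Fintype.card ι : ℂ) ≠ 0 := by
    have : Nonempty ι := ⟨i⟩
    exact_mod_cast Fintype.card_ne_zero
  -- The scalar is found by taking traces: each of the conjugates of the matrix unit has trace
  -- δ_{ia}.
  have htr : (if i = a then (Fintype.card G : ℂ) else 0) = c * Fintype.card ι := by
    have := congrArg Matrix.trace hc
    rw [Matrix.trace_sum, Matrix.trace_smul, Matrix.trace_one, smul_eq_mul] at this
    rw [← this]
    have h1 : ∀ g, Matrix.trace ((φ g⁻¹ : Matrix ι ι ℂ) * Matrix.single i a 1 *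
        (φ g : Matrix ι ι ℂ)) = if i = a then 1 else 0 := by
      intro g
      rw [Matrix.trace_mul_comm, ← mul_assoc, ← coe_mul_unitary]
      rw [mul_inv_cancel, map_one]
      rcases eq_or_ne i a with rfl | hia
      · simp
      · simp [hia, Matrix.trace_single_eq_of_ne]
    rw [Finset.sum_congr rfl fun g _ => h1 g]
    simp
  have h2 := congrFun (congrFun hc j) b
  rw [Matrix.sum_apply] at h2
  have h3 : ∀ g, ((φ g⁻¹ : Matrix ι ι ℂ) * Matrix.single i a 1 * (φ g : Matrix ι ι ℂ) :
      Matrix ι ι ℂ) j b =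
      (φ g⁻¹ : Matrix ι ι ℂ) j i * (φ g : Matrix ι ι ℂ) a b := by
    intro g
    rw [Matrix.mul_assoc, Matrix.mul_apply, Finset.sum_eq_single i]
    · simp
    · intro b _ hb
      simp [hb]
    · simp
  rw [Finset.sum_congr rfl fun g _ => h3 g] at h2
  rw [h2]
  by_cases hia : i = a
  · rw [if_pos hia] at htr
    by_cases hjb : j = b
    · simp [hia, hjb, htr, hι]
    · simp [hjb]
  · rw [if_neg hia] at htr
    have : c = 0 := by simpa [hι] using htr.symm
    simp [hia, this]

/-- Schur orthogonality for the matrix elements of inequivalent irreducible representations. -/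
theorem sum_matrixElement_mul_of_ne
    (h : ∀ Z : Matrix ι κ ℂ, (∀ g, (φ g : Matrix ι ι ℂ) * Z = Z * (ψ g : Matrix κ κ ℂ)) → Z = 0)
    (i j : ι) (a b : κ) :
    ∑ g, (φ g⁻¹ : Matrix ι ι ℂ) j i * (ψ g : Matrix κ κ ℂ) a b = 0 := by
  have h2 := congrFun (congrFun (h _ (sum_conj_intertwines φ ψ (Matrix.single i a 1))) j) b
  rw [Matrix.sum_apply] at h2
  rw [Matrix.zero_apply] at h2
  rw [← h2]
  refine Finset.sum_congr rfl fun g _ => ?_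
  rw [Matrix.mul_assoc, Matrix.mul_apply, Finset.sum_eq_single i]
  · simp
  · intro b _ hb
    simp [hb]
  · simp

end Schur

/-! ### Young symmetrizers -/

section Tableau

variable {n : ℕ} {μ ν : Shape n}

/-- The row of the entry `i` of a tableau. -/
def rowOf (T : μ.1.cells ≃ Fin n) (i : Fin n) : ℕ := (T.symm i).1.1

/-- The column of the entry `i` of a tableau. -/
def colOf (T : μ.1.cells ≃ Fin n) (i : Fin n) : ℕ := (T.symm i).1.2

theorem eq_of_rowOf_colOf (T : μ.1.cells ≃ Fin n) {i j : Fin n} (h : rowOf T i = rowOf T j)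
    (h' : colOf T i = colOf T j) : i = j :=
  T.symm.injective (Subtype.ext (Prod.ext h h'))

/-- `T` and `S` have no two entries that are in one row of `T` and in one column of `S`. -/
def RowColDisjoint (T : μ.1.cells ≃ Fin n) (S : ν.1.cells ≃ Fin n) : Prop :=
  ∀ i j, rowOf T i = rowOf T j → colOf S i = colOf S j → i = j

theorem card_colOf (S : ν.1.cells ≃ Fin n) (c : ℕ) :
    (Finset.univ.filter fun j => colOf S j = c).card = ν.1.colLen c := by
  rw [YoungDiagram.colLen_eq_card]
  refine Finset.card_bij (fun j _ => (S.symm j).1) ?_ ?_ ?_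
  · intro j hj
    exact YoungDiagram.mem_col_iff.2 ⟨(S.symm j).2, (Finset.mem_filter.1 hj).2⟩
  · intro i _ j _ h
    exact S.symm.injective (Subtype.ext h)
  · intro b hb
    rw [YoungDiagram.mem_col_iff] at hb
    exact ⟨S ⟨b, hb.1⟩, Finset.mem_filter.2 ⟨Finset.mem_univ _, by simpa [colOf] using hb.2⟩, by simp⟩

theorem card_rowOf (S : ν.1.cells ≃ Fin n) (r : ℕ) :
    (Finset.univ.filter fun j => rowOf S j = r).card = ν.1.rowLen r := by
  rw [YoungDiagram.rowLen_eq_card]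
  refine Finset.card_bij (fun j _ => (S.symm j).1) ?_ ?_ ?_
  · intro j hj
    exact YoungDiagram.mem_row_iff.2 ⟨(S.symm j).2, (Finset.mem_filter.1 hj).2⟩
  · intro i _ j _ h
    exact S.symm.injective (Subtype.ext h)
  · intro b hb
    rw [YoungDiagram.mem_row_iff] at hb
    exact ⟨S ⟨b, hb.1⟩, Finset.mem_filter.2 ⟨Finset.mem_univ _, by simpa [rowOf] using hb.2⟩, by simp⟩

/-- If `T` and `S` are disjoint in this sense, the entries can be moved upwards within the columns of
`S`, so that the row of each entry is at most its row in `T`. -/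
theorem RowColDisjoint.exists_tableau {T : μ.1.cells ≃ Fin n} {S : ν.1.cells ≃ Fin n}
    (h : RowColDisjoint T S) : ∃ S' : ν.1.cells ≃ Fin n, ∀ i, rowOf S' i ≤ rowOf T i := by
  -- Each column of `S` is sorted by the rows of `T`, and `rk i` is the new row of `i`. Disjointness
  -- makes the `T`-rows within a column distinct, so ranks do not collide; the `rk i` entries
  -- counted have distinct `T`-rows below that of `i`, so `rk i ≤ rowOf T i`.
  let rk : Fin n → ℕ := fun i =>
    (Finset.univ.filter fun j => colOf S j = colOf S i ∧ rowOf T j < rowOf T i).card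
  have hlt : ∀ i, (rk i, colOf S i) ∈ ν.1.cells := by
    intro i
    rw [YoungDiagram.mem_cells, YoungDiagram.mem_iff_lt_colLen, ← card_colOf S]
    refine Finset.card_lt_card ?_
    rw [Finset.ssubset_iff_of_subset]
    · exact ⟨i, by simp, by simp⟩
    · intro j hj
      simp only [Finset.mem_filter, Finset.mem_univ, true_and] at hj ⊢
      exact hj.1
  have hmono : ∀ i j, colOf S i = colOf S j → rowOf T i < rowOf T j → rk i < rk j := by
    intro i j hc hr
    refine Finset.card_lt_card ?_
    rw [Finset.ssubset_iff_of_subset]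
    · exact ⟨i, by simp [hc, hr], by simp⟩
    · intro l hl
      simp only [Finset.mem_filter, Finset.mem_univ, true_and] at hl ⊢
      exact ⟨hl.1.trans hc, hl.2.trans hr⟩
  have hinj : Function.Injective (fun i => (⟨(rk i, colOf S i), hlt i⟩ : ν.1.cells)) := by
    intro i j hij
    have h1 : rk i = rk j := congrArg (fun x => x.1.1) hij
    have h2 : colOf S i = colOf S j := congrArg (fun x => x.1.2) hij
    rcases lt_trichotomy (rowOf T i) (rowOf T j) with h3 | h3 | h3
    · exact absurd h1 (hmono _ _ h2 h3).ne
    · exact h i j h3 h2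
    · exact absurd h1.symm (hmono _ _ h2.symm h3).ne
  have hbij := (Fintype.bijective_iff_injective_and_card _).2 ⟨hinj, by
    rw [Fintype.card_coe, Fintype.card_fin]
    exact ν.2.symm⟩
  refine ⟨(Equiv.ofBijective _ hbij).symm, fun i => ?_⟩
  change rk i ≤ rowOf T i
  calc rk i ≤ (Finset.range (rowOf T i)).card := by
        refine Finset.card_le_card_of_injOn (rowOf T) ?_ ?_
        · intro j hj
          simp only [Finset.coe_filter, Finset.mem_univ, true_and, Set.mem_ofPred_eq] at hj
          simpa using hj.2
        · intro a ha b hb hab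
          simp only [Finset.coe_filter, Finset.mem_univ, true_and, Set.mem_ofPred_eq] at ha hb
          exact h a b hab (ha.1.trans hb.1.symm)
    _ = rowOf T i := Finset.card_range _

/-- This sum depends only on the shape, and it takes over the role of the dominance order in
comparing shapes. -/
theorem sum_rowOf (T T' : μ.1.cells ≃ Fin n) : ∑ i, rowOf T i = ∑ i, rowOf T' i :=
  Fintype.sum_equiv (T.symm.trans T') _ _ (fun i => by simp [rowOf])

theorem shape_eq_of_rowLen (h : ∀ r, μ.1.rowLen r = ν.1.rowLen r) : μ = ν := by
  apply Subtype.ext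
  apply YoungDiagram.ext
  ext ⟨i, j⟩
  simp [YoungDiagram.mem_cells, YoungDiagram.mem_iff_lt_rowLen, h]

/-- Rearranging columns gives `S1 ≤ T` and `T1 ≤ S'` rowwise. Since the sum of rows is a shape
invariant, the sums for `T` and `S1` bound each other, so the rows of `S1` and `T` agree entry by
entry and the row lengths coincide. -/
theorem shape_eq_of_rowColDisjoint {T T' : μ.1.cells ≃ Fin n} {S S' : ν.1.cells ≃ Fin n}
    (h : RowColDisjoint T S) (h' : RowColDisjoint S' T') : μ = ν := by
  obtain ⟨S1, hS1⟩ := h.exists_tableau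
  obtain ⟨T1, hT1⟩ := h'.exists_tableau
  have hle : ∑ i, rowOf T i ≤ ∑ i, rowOf S1 i := by
    rw [sum_rowOf T T1, sum_rowOf S1 S']
    exact Finset.sum_le_sum fun i _ => hT1 i
  have heq : ∀ i, rowOf S1 i = rowOf T i := by
    intro i
    exact (Finset.sum_eq_sum_iff_of_le (fun i _ => hS1 i)).1
      (le_antisymm (Finset.sum_le_sum fun i _ => hS1 i) hle) i (Finset.mem_univ i)
  apply shape_eq_of_rowLen
  intro r
  rw [← card_rowOf T, ← card_rowOf S1]
  simp [heq]

/-- The permutations preserving a colouring of the points. -/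
abbrev Preserving (f : Fin n → ℕ) : Type := {p : Equiv.Perm (Fin n) // ∀ i, f (p i) = f i}

open Classical in
/-- The sum of the permutations preserving a colouring. -/
def symmetrizer (f : Fin n → ℕ) : MonoidAlgebra ℂ (Equiv.Perm (Fin n)) :=
  ∑ p : Preserving f, MonoidAlgebra.single p.1 1

open Classical in
/-- The alternating sum of the permutations preserving a colouring. -/
def antisymmetrizer (f : Fin n → ℕ) : MonoidAlgebra ℂ (Equiv.Perm (Fin n)) :=
  ∑ p : Preserving f, MonoidAlgebra.single p.1 ((Equiv.Perm.sign p.1 : ℤ) : ℂ)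

theorem preserving_swap {f : Fin n → ℕ} {i j : Fin n} (h : f i = f j) (l : Fin n) :
    f (Equiv.swap i j l) = f l := by
  rcases eq_or_ne l i with rfl | hi
  · simp [h]
  · rcases eq_or_ne l j with rfl | hj
    · simp [h]
    · rw [Equiv.swap_apply_of_ne_of_ne hi hj]

theorem single_swap_mul_symmetrizer {f : Fin n → ℕ} {i j : Fin n} (h : f i = f j) :
    MonoidAlgebra.single (Equiv.swap i j) 1 * symmetrizer f = symmetrizer f := by
  classical
  rw [symmetrizer, Finset.mul_sum]
  have hs : Function.Involutive (fun p : Preserving f =>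
      (⟨Equiv.swap i j * p.1, fun l => by simp [preserving_swap h, p.2]⟩ : Preserving f)) := by
    intro p
    simp
  refine Fintype.sum_equiv hs.toPerm _ _ fun p => ?_
  simp [MonoidAlgebra.single_mul_single]

theorem antisymmetrizer_mul_single_swap {f : Fin n → ℕ} {i j : Fin n} (hij : i ≠ j) (h : f i = f j) :
    antisymmetrizer f * MonoidAlgebra.single (Equiv.swap i j) 1 = -antisymmetrizer f := by
  classical
  rw [antisymmetrizer, Finset.sum_mul, ← Finset.sum_neg_distrib]
  have hs : Function.Involutive (fun p : Preserving f =>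
      (⟨p.1 * Equiv.swap i j, fun l => by simp [preserving_swap h, p.2]⟩ : Preserving f)) := by
    intro p
    simp [mul_assoc]
  refine Fintype.sum_equiv hs.toPerm _ _ fun p => ?_
  simp [MonoidAlgebra.single_mul_single, Equiv.Perm.sign_mul, Equiv.Perm.sign_swap hij,
    MonoidAlgebra.single_neg]

/-- The Young symmetrizer of a tableau, in the group algebra. -/
def youngElement (T : μ.1.cells ≃ Fin n) : MonoidAlgebra ℂ (Equiv.Perm (Fin n)) :=
  symmetrizer (rowOf T) * antisymmetrizer (colOf T)

theorem groupAlgHom_youngElement {ι : Type*} [Fintype ι] [DecidableEq ι] (T : μ.1.cells ≃ Fin n)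
    (φ : Equiv.Perm (Fin n) →* Matrix.unitaryGroup ι ℂ) :
    groupAlgHom φ (youngElement T) = youngSymmetrizer T φ := by
  classical
  rw [youngElement, symmetrizer, antisymmetrizer, youngSymmetrizer, Finset.sum_mul_sum, map_sum]
  simp only [MonoidAlgebra.single_mul_single, map_sum, groupAlgHom_single, one_mul]
  refine Fintype.sum_equiv (Equiv.subtypeEquivRight fun p => ?_) _ _ fun p =>
    Fintype.sum_equiv (Equiv.subtypeEquivRight fun q => ?_) _ _ fun q => rfl
  · exact ⟨fun h c => by simpa [rowOf] using h (T c), fun h i => by simpa [rowOf] using h (T.symm i)⟩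
  · exact ⟨fun h c => by simpa [colOf] using h (T c), fun h i => by simpa [colOf] using h (T.symm i)⟩

/-- Two entries in one row of `gT` and one column of `S` give a transposition that the symmetrizer
absorbs with sign +1 and the antisymmetrizer with sign -1. The product is therefore its own
negative. -/
theorem antisymmetrizer_mul_single_mul_symmetrizer {T : μ.1.cells ≃ Fin n} {S : ν.1.cells ≃ Fin n}
    (g : Equiv.Perm (Fin n)) (h : ¬RowColDisjoint (T.trans g) S) :
    antisymmetrizer (colOf S) * MonoidAlgebra.single g 1 * symmetrizer (rowOf T) = 0 := by
  simp only [RowColDisjoint, not_forall] at h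
  obtain ⟨i, j, hr, hc, hij⟩ := h
  have hr' : rowOf T (g⁻¹ i) = rowOf T (g⁻¹ j) := hr
  have h1 : Equiv.swap i j * g = g * Equiv.swap (g⁻¹ i) (g⁻¹ j) := by
    rw [Equiv.mul_swap_eq_swap_mul]
    simp
  have h2 : antisymmetrizer (colOf S) * MonoidAlgebra.single g 1 * symmetrizer (rowOf T) =
      -(antisymmetrizer (colOf S) * MonoidAlgebra.single g 1 * symmetrizer (rowOf T)) := by
    conv_lhs => rw [← single_swap_mul_symmetrizer hr', ← mul_assoc, mul_assoc (antisymmetrizer _),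
      MonoidAlgebra.single_mul_single, ← h1, ← MonoidAlgebra.single_mul_single,
      ← mul_assoc, antisymmetrizer_mul_single_swap hij hc]
    simp
  have h3 : (2 : ℂ) • (antisymmetrizer (colOf S) * MonoidAlgebra.single g 1 *
      symmetrizer (rowOf T)) = 0 := by
    rw [two_smul]
    nth_rw 1 [h2]
    simp
  exact (smul_eq_zero.1 h3).resolve_left two_ne_zero

/-- A group element between the two symmetrizers replaces `T` by `gT`, which is why the hypothesis
ranges over all tableaux of shape `μ`. -/
theorem youngElement_mul_mul {T : μ.1.cells ≃ Fin n} {S : ν.1.cells ≃ Fin n}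
    (h : ∀ T' : μ.1.cells ≃ Fin n, ¬RowColDisjoint T' S) (x : MonoidAlgebra ℂ (Equiv.Perm (Fin n))) :
    youngElement S * x * youngElement T = 0 := by
  induction x using MonoidAlgebra.induction_linear with
  | zero => simp
  | add x y hx hy => rw [mul_add, add_mul, hx, hy, add_zero]
  | single g c =>
    have h1 : (MonoidAlgebra.single g c : MonoidAlgebra ℂ (Equiv.Perm (Fin n))) =
        c • MonoidAlgebra.single g 1 := by simp
    have h2 := antisymmetrizer_mul_single_mul_symmetrizer g (h (T.trans g))
    rw [youngElement, youngElement, h1, mul_smul_comm, smul_mul_assoc, ← mul_assoc,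
      mul_assoc (symmetrizer (rowOf S)), mul_assoc (symmetrizer (rowOf S)), h2]
    simp

/-- An irreducible representation which is not annihilated by the Young symmetrizers of two
tableaux determines their shape. -/
theorem shape_eq_of_irreducible {ι : Type*} [Fintype ι] [DecidableEq ι]
    (φ : Equiv.Perm (Fin n) →* Matrix.unitaryGroup ι ℂ) (hφ : (matrixRep φ).IsIrreducible)
    (T : μ.1.cells ≃ Fin n) (S : ν.1.cells ≃ Fin n) (hT : groupAlgHom φ (youngElement T) ≠ 0)
    (hS : groupAlgHom φ (youngElement S) ≠ 0) : μ = ν := by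
  by_contra hne
  by_cases h : ∀ T' : μ.1.cells ≃ Fin n, ¬RowColDisjoint T' S
  · obtain ⟨x, hx⟩ := exists_mul_mul_ne_zero φ hφ hS hT
    exact hx (youngElement_mul_mul h x)
  · push Not at h
    obtain ⟨T', hT'⟩ := h
    obtain ⟨x, hx⟩ := exists_mul_mul_ne_zero φ hφ hT hS
    exact hx (youngElement_mul_mul (fun S' hS' => hne (shape_eq_of_rowColDisjoint hT' hS')) x)

end Tableau

/-! ### Conjugacy classes and Young diagrams -/

theorem card_cellsOfRowLens (w : List ℕ) : (YoungDiagram.cellsOfRowLens w).card = w.sum := by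
  induction w with
  | nil => rfl
  | cons a w ih =>
    rw [YoungDiagram.cellsOfRowLens, Finset.card_union_of_disjoint]
    · simp [ih]
    · rw [Finset.disjoint_left]
      rintro ⟨i, j⟩ h1 h2
      simp only [Finset.mem_product, Finset.mem_singleton, Finset.mem_map] at h1 h2
      obtain ⟨⟨a, b⟩, -, h⟩ := h2
      have : a + 1 = i := congrArg Prod.fst h
      omega

/-- The Young diagram of a partition. -/
def shapeOfPartition {n : ℕ} (p : n.Partition) : Shape n :=
  ⟨YoungDiagram.ofRowLens (p.parts.sort (· ≥ ·)) (p.parts.pairwise_sort (· ≥ ·)).sortedGE, by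
    change (YoungDiagram.cellsOfRowLens _).card = n
    rw [card_cellsOfRowLens, ← Multiset.sum_coe, Multiset.sort_eq, p.parts_sum]⟩

theorem shapeOfPartition_injective {n : ℕ} :
    Function.Injective (shapeOfPartition : n.Partition → Shape n) := by
  intro p q h
  have hrow : ∀ p : n.Partition, (shapeOfPartition p).1.rowLens = p.parts.sort (· ≥ ·) := fun p =>
    YoungDiagram.rowLens_ofRowLens_eq_self
      (hw := (p.parts.pairwise_sort (· ≥ ·)).sortedGE) fun x hx => p.parts_pos (by simpa using hx)
  have h1 : p.parts.sort (· ≥ ·) = q.parts.sort (· ≥ ·) := by rw [← hrow p, h, hrow q]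
  apply Nat.Partition.ext
  rw [← Multiset.sort_eq p.parts (· ≥ ·), h1, Multiset.sort_eq]

instance finiteShape (n : ℕ) : Finite (Shape n) := by
  refine Finite.of_injective
    (fun μ : Shape n => (⟨μ.1.cells, ?_⟩ :
      {s // s ∈ (Finset.range n ×ˢ Finset.range n).powerset})) ?_
  · rw [Finset.mem_powerset]
    rintro ⟨i, j⟩ hij
    have hc : ∀ s : Finset (ℕ × ℕ), s ⊆ μ.1.cells → s.card ≤ n := fun s hs =>
      (Finset.card_le_card hs).trans_eq μ.2
    -- The cells weakly above `(i, j)` in its column number `i + 1`, those weakly to its left in its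
    -- row `j + 1`; both counts are at most `n`.
    have h1 := hc ((Finset.range (i + 1)).map ⟨fun a => (a, j), fun a b h => by simpa using h⟩) (by
      intro c hc
      obtain ⟨a, ha, rfl⟩ := Finset.mem_map.1 hc
      exact μ.1.up_left_mem (Nat.lt_succ_iff.1 (Finset.mem_range.1 ha)) le_rfl hij)
    have h2 := hc ((Finset.range (j + 1)).map ⟨fun a => (i, a), fun a b h => by simpa using h⟩) (by
      intro c hc
      obtain ⟨a, ha, rfl⟩ := Finset.mem_map.1 hc
      exact μ.1.up_left_mem le_rfl (Nat.lt_succ_iff.1 (Finset.mem_range.1 ha)) hij)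
    rw [Finset.card_map, Finset.card_range] at h1 h2
    simp only [Finset.mem_product, Finset.mem_range]
    omega
  · intro α β h
    exact Subtype.ext (YoungDiagram.ext (congrArg Subtype.val h))

instance fintypeShape (n : ℕ) : Fintype (Shape n) := Fintype.ofFinite _

/-- Cycle types embed the classes into partitions, hence into diagrams. Only this inequality is
needed: the reverse one comes from the independence of the characters. -/
theorem card_conjClasses_le (n : ℕ) :
    Nat.card (ConjClasses (Equiv.Perm (Fin n))) ≤ Nat.card (Shape n) := by
  have h1 : Nat.card (ConjClasses (Equiv.Perm (Fin n))) ≤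
      Nat.card (Fintype.card (Fin n)).Partition := by
    refine Nat.card_le_card_of_injective (Quotient.lift (s := IsConj.setoid _) Equiv.Perm.partition
      fun a b h => Equiv.Perm.partition_eq_of_isConj.1 h) ?_
    rintro ⟨a⟩ ⟨b⟩ h
    exact Quotient.sound (s := IsConj.setoid _) (Equiv.Perm.partition_eq_of_isConj.2 h)
  have h2 := Nat.card_le_card_of_injective _
    (shapeOfPartition_injective (n := Fintype.card (Fin n)))
  rw [Fintype.card_fin] at h2
  rw [Fintype.card_fin] at h1
  exact h1.trans h2

/-! ### Matrix units in the group algebra -/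

section Units

variable (φ : (n : ℕ) → (μ : Shape n) → Equiv.Perm (Fin n) →* Matrix.unitaryGroup (Idx n μ) ℂ)

-- A nonzero intertwiner would make `φ^ν` survive the Young symmetrizers of both shapes, which
-- forces the shapes to agree.
variable {φ} in
theorem IsPRIR.intertwiner_eq_zero (hφ : IsPRIR φ) {n : ℕ} {μ ν : Shape n} (hne : μ ≠ ν)
    (Z : Matrix (Idx n μ) (Idx n ν) ℂ) (hZ : ∀ g, (φ n μ g : Matrix (Idx n μ) (Idx n μ) ℂ) * Z =
      Z * (φ n ν g : Matrix (Idx n ν) (Idx n ν) ℂ)) : Z = 0 := by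
  by_contra h0
  obtain ⟨T, hT⟩ := hφ.label n μ
  obtain ⟨S, hS⟩ := hφ.label n ν
  rw [← groupAlgHom_youngElement] at hT hS
  exact hne (shape_eq_of_irreducible _ (hφ.irreducible n ν) T S
    (groupAlgHom_ne_zero_of_intertwines _ _ (hφ.irreducible n μ) (hφ.irreducible n ν) Z h0 hZ hT) hS)

variable {φ} in
theorem IsPRIR.youngElement_eq_zero (hφ : IsPRIR φ) {n : ℕ} {μ ν : Shape n} (hne : μ ≠ ν)
    (T : μ.1.cells ≃ Fin n) : groupAlgHom (φ n ν) (youngElement T) = 0 := by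
  by_contra h
  obtain ⟨S, hS⟩ := hφ.label n ν
  rw [← groupAlgHom_youngElement] at hS
  exact hne (shape_eq_of_irreducible _ (hφ.irreducible n ν) T S h hS)

/-- The matrix units `(d_μ / n!) ∑_τ φ^μ_{ji}(τ⁻¹) τ` of the group algebra. -/
def matUnit {n : ℕ} (μ : Shape n) (i j : Idx n μ) : MonoidAlgebra ℂ (Equiv.Perm (Fin n)) :=
  ((Fintype.card (Idx n μ) : ℂ) / (n.factorial : ℂ)) •
    ∑ τ : Equiv.Perm (Fin n),
      MonoidAlgebra.single τ ((φ n μ τ⁻¹ : Matrix (Idx n μ) (Idx n μ) ℂ) j i)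

theorem sum_single_eq {M α : Type*} (s : Finset α) (g : M) (f : α → ℂ) :
    ∑ a ∈ s, (MonoidAlgebra.single g (f a) : MonoidAlgebra ℂ M) =
      MonoidAlgebra.single g (∑ a ∈ s, f a) :=
  (map_sum (MonoidAlgebra.singleAddHom g) f s).symm

/-- Translating the summation variable by `g` shows that for fixed `j` the matrix units transform
like the basis of `φ^μ`. Only multiplicativity of `φ^μ` enters, not irreducibility. -/
theorem single_mul_matUnit {n : ℕ} (μ : Shape n) (i j : Idx n μ) (g : Equiv.Perm (Fin n)) :
    MonoidAlgebra.single g 1 * matUnit φ μ i j =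
      ∑ a, (φ n μ g : Matrix (Idx n μ) (Idx n μ) ℂ) a i • matUnit φ μ a j := by
  simp only [matUnit, mul_smul_comm, smul_comm _ ((Fintype.card (Idx n μ) : ℂ) / _)]
  rw [← Finset.smul_sum]
  congr 1
  simp only [Finset.mul_sum, Finset.smul_sum]
  rw [Finset.sum_comm]
  refine Fintype.sum_equiv (Equiv.mulLeft g) _ _ fun τ => ?_
  have h : (φ n μ τ⁻¹ : Matrix (Idx n μ) (Idx n μ) ℂ) =
      (φ n μ (g * τ)⁻¹ : Matrix (Idx n μ) (Idx n μ) ℂ) * (φ n μ g : Matrix _ _ ℂ) := by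
    rw [← coe_mul_unitary]
    congr 2
    group
  rw [MonoidAlgebra.single_mul_single, h, one_mul, Matrix.mul_apply]
  simp only [MonoidAlgebra.smul_single, smul_eq_mul, Equiv.coe_mulLeft]
  rw [sum_single_eq]
  simp only [mul_comm]

theorem mul_matUnit {n : ℕ} (μ : Shape n) (i j : Idx n μ)
    (x : MonoidAlgebra ℂ (Equiv.Perm (Fin n))) :
    x * matUnit φ μ i j = ∑ a, groupAlgHom (φ n μ) x a i • matUnit φ μ a j := by
  induction x using MonoidAlgebra.induction_linear with
  | zero => simp
  | add x y hx hy => simp [add_mul, hx, hy, add_smul, Finset.sum_add_distrib]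
  | single g c =>
    have h1 : (MonoidAlgebra.single g c : MonoidAlgebra ℂ (Equiv.Perm (Fin n))) =
        c • MonoidAlgebra.single g 1 := by simp
    rw [h1, smul_mul_assoc, single_mul_matUnit, map_smul, groupAlgHom_single, Finset.smul_sum]
    simp [smul_smul]

variable {φ}

theorem IsPRIR.groupAlgHom_matUnit (hφ : IsPRIR φ) {n : ℕ} (μ : Shape n) (i j : Idx n μ) :
    groupAlgHom (φ n μ) (matUnit φ μ i j) = Matrix.single i j 1 := by
  have hd : (Fintype.card (Idx n μ) : ℂ) ≠ 0 := by
    have : Nonempty (Idx n μ) := ⟨i⟩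
    exact_mod_cast Fintype.card_ne_zero
  have hn : (n.factorial : ℂ) ≠ 0 := by exact_mod_cast n.factorial_ne_zero
  ext a b
  simp only [matUnit, map_smul, map_sum, groupAlgHom_single, Matrix.smul_apply, Matrix.sum_apply,
    smul_eq_mul]
  rw [sum_matrixElement_mul_self _ (hφ.irreducible n μ), Fintype.card_perm, Fintype.card_fin]
  simp only [Matrix.single_apply, and_comm]
  split_ifs
  · field_simp
  · simp

theorem IsPRIR.groupAlgHom_matUnit_of_ne (hφ : IsPRIR φ) {n : ℕ} {μ ν : Shape n} (hne : μ ≠ ν)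
    (i j : Idx n μ) : groupAlgHom (φ n ν) (matUnit φ μ i j) = 0 := by
  ext a b
  simp only [matUnit, map_smul, map_sum, groupAlgHom_single, Matrix.smul_apply, Matrix.sum_apply,
    smul_eq_mul]
  rw [sum_matrixElement_mul_of_ne _ _ (hφ.intertwiner_eq_zero hne)]
  simp

theorem IsPRIR.matUnit_mul_matUnit (hφ : IsPRIR φ) {n : ℕ} (μ : Shape n) (i j k l : Idx n μ) :
    matUnit φ μ i j * matUnit φ μ k l = if j = k then matUnit φ μ i l else 0 := by
  rw [mul_matUnit, hφ.groupAlgHom_matUnit, Finset.sum_eq_single i]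
  · simp only [Matrix.single_apply, true_and]
    split_ifs <;> simp
  · intro b _ hb
    simp [hb.symm]
  · simp

theorem IsPRIR.matUnit_mul_of_ne (hφ : IsPRIR φ) {n : ℕ} {μ ν : Shape n} (hne : μ ≠ ν)
    (i j : Idx n μ) (k l : Idx n ν) : matUnit φ μ i j * matUnit φ ν k l = 0 := by
  simp [mul_matUnit, hφ.groupAlgHom_matUnit_of_ne hne]

theorem IsPRIR.sum_character_mul (hφ : IsPRIR φ) {n : ℕ} (μ ν : Shape n) :
    ∑ g, Matrix.trace (φ n μ g⁻¹ : Matrix (Idx n μ) (Idx n μ) ℂ) *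
      Matrix.trace (φ n ν g : Matrix (Idx n ν) (Idx n ν) ℂ) =
    if μ = ν then (n.factorial : ℂ) else 0 := by
  simp only [Matrix.trace, Matrix.diag_apply, Finset.sum_mul_sum]
  rw [Finset.sum_comm]
  simp only [Finset.sum_comm (s := (Finset.univ : Finset (Equiv.Perm (Fin n))))]
  split_ifs with h
  · subst h
    simp only [sum_matrixElement_mul_self _ (hφ.irreducible n μ), and_self]
    have hd : (Fintype.card (Idx n μ) : ℂ) ≠ 0 := by
      obtain ⟨T, hT⟩ := hφ.label n μ
      have : Nonempty (Idx n μ) := by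
        by_contra hE
        rw [not_nonempty_iff] at hE
        exact hT (Subsingleton.elim _ _)
      exact_mod_cast Fintype.card_ne_zero
    simp [Fintype.card_perm]
    field_simp
  · simp only [sum_matrixElement_mul_of_ne _ _ (hφ.intertwiner_eq_zero h), Finset.sum_const_zero]

/-- The characters of the symmetric group as functions on the conjugacy classes. -/
def characterOnClasses (φ : (n : ℕ) → (μ : Shape n) →
    Equiv.Perm (Fin n) →* Matrix.unitaryGroup (Idx n μ) ℂ) {n : ℕ} (μ : Shape n) :
    ConjClasses (Equiv.Perm (Fin n)) → ℂ :=
  Quotient.lift (s := IsConj.setoid _)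
    (fun g => Matrix.trace (φ n μ g : Matrix (Idx n μ) (Idx n μ) ℂ)) (by
      intro a b h
      obtain ⟨c, rfl⟩ := isConj_iff.1 h
      change _ = Matrix.trace (φ n μ (c * a * c⁻¹) : Matrix (Idx n μ) (Idx n μ) ℂ)
      rw [coe_mul_unitary, Matrix.trace_mul_comm, ← coe_mul_unitary]
      simp)

theorem IsPRIR.linearIndependent_characters (hφ : IsPRIR φ) (n : ℕ) :
    LinearIndependent ℂ (fun μ : Shape n => characterOnClasses φ μ) := by
  rw [Fintype.linearIndependent_iff]
  intro c hc μ
  have hn : (n.factorial : ℂ) ≠ 0 := by exact_mod_cast n.factorial_ne_zero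
  have h1 : ∀ g, ∑ ν, c ν * Matrix.trace (φ n ν g : Matrix (Idx n ν) (Idx n ν) ℂ) = 0 := by
    intro g
    have := congrFun hc (ConjClasses.mk g)
    rw [Finset.sum_apply] at this
    exact this
  have h2 : ∑ ν, c ν * ∑ g, Matrix.trace (φ n μ g⁻¹ : Matrix (Idx n μ) (Idx n μ) ℂ) *
      Matrix.trace (φ n ν g : Matrix (Idx n ν) (Idx n ν) ℂ) = 0 := by
    simp only [Finset.mul_sum]
    rw [Finset.sum_comm]
    refine Finset.sum_eq_zero fun g _ => ?_
    have := congrArg (Matrix.trace (φ n μ g⁻¹ : Matrix (Idx n μ) (Idx n μ) ℂ) * ·) (h1 g)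
    simp only [Finset.mul_sum, mul_zero] at this
    rw [← this]
    exact Finset.sum_congr rfl fun ν _ => by ring
  simp only [hφ.sum_character_mul] at h2
  simpa [hn] using h2

/-- The characters are independent and at least as numerous as the classes, so they form a basis of
the class functions; the indicator of the identity class is one of these. The coefficients are never
needed. -/
theorem IsPRIR.exists_sum_character (hφ : IsPRIR φ) (n : ℕ) : ∃ c : Shape n → ℂ,
    ∀ g : Equiv.Perm (Fin n), ∑ μ, c μ * Matrix.trace (φ n μ g : Matrix (Idx n μ) (Idx n μ) ℂ) =
      if g = 1 then 1 else 0 := by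
  classical
  have hli := hφ.linearIndependent_characters n
  have := Fintype.ofFinite (ConjClasses (Equiv.Perm (Fin n)))
  have hcard : Fintype.card (Shape n) =
      Module.finrank ℂ (ConjClasses (Equiv.Perm (Fin n)) → ℂ) := by
    refine le_antisymm hli.fintype_card_le_finrank ?_
    have := card_conjClasses_le n
    rw [Nat.card_eq_fintype_card, Nat.card_eq_fintype_card] at this
    simpa using this
  have hspan := hli.span_eq_top_of_card_eq_finrank' hcard
  have hmem : (Pi.single (ConjClasses.mk 1) 1 : ConjClasses (Equiv.Perm (Fin n)) → ℂ) ∈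
      Submodule.span ℂ (Set.range fun μ : Shape n => characterOnClasses φ μ) := by
    rw [hspan]
    trivial
  obtain ⟨c, hc⟩ := (Submodule.mem_span_range_iff_exists_fun ℂ).1 hmem
  refine ⟨c, fun g => ?_⟩
  have h := congrFun hc (ConjClasses.mk g)
  simp only [Finset.sum_apply, Pi.smul_apply, smul_eq_mul, Pi.single_apply,
    ConjClasses.mk_eq_mk_iff_isConj, isConj_one_left] at h
  exact h

/-- The identity of the group algebra is a combination of the diagonal matrix units. -/
theorem IsPRIR.exists_one_eq_sum (hφ : IsPRIR φ) (n : ℕ) : ∃ c : Shape n → ℂ,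
    (1 : MonoidAlgebra ℂ (Equiv.Perm (Fin n))) = ∑ μ, c μ • ∑ i, matUnit φ μ i i := by
  obtain ⟨c, hc⟩ := hφ.exists_sum_character n
  have hn : (n.factorial : ℂ) ≠ 0 := by exact_mod_cast n.factorial_ne_zero
  -- The factor n!/d_μ undoes the normalization of `matUnit`.
  refine ⟨fun μ => c μ * (n.factorial / Fintype.card (Idx n μ)), ?_⟩
  have h1 : ∀ μ : Shape n, (c μ * (n.factorial / Fintype.card (Idx n μ)) : ℂ) •
      ∑ i, matUnit φ μ i i = ∑ g : Equiv.Perm (Fin n), MonoidAlgebra.single g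
        (c μ * Matrix.trace (φ n μ g⁻¹ : Matrix (Idx n μ) (Idx n μ) ℂ)) := by
    intro μ
    by_cases hE : Nonempty (Idx n μ)
    · have hd : (Fintype.card (Idx n μ) : ℂ) ≠ 0 := by exact_mod_cast Fintype.card_ne_zero
      simp only [matUnit]
      rw [← Finset.smul_sum, smul_smul, Finset.sum_comm, Finset.smul_sum]
      refine Finset.sum_congr rfl fun g _ => ?_
      rw [sum_single_eq, MonoidAlgebra.smul_single, Matrix.trace]
      congr 1
      simp only [Matrix.diag_apply, smul_eq_mul]
      field_simp
    · rw [not_nonempty_iff] at hE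
      simp [Matrix.trace]
  rw [Finset.sum_congr rfl fun μ _ => h1 μ, Finset.sum_comm]
  simp only [sum_single_eq, hc, inv_eq_one]
  rw [Finset.sum_eq_single 1]
  · simp [MonoidAlgebra.one_def]
  · intro g _ hg
    simp [hg]
  · simp

/-- Writing x = x · 1 and expanding 1, each product of x with a matrix unit is again a combination
of matrix units. No dimension count of the form ∑ d_μ² = n! is required. -/
theorem IsPRIR.span_matUnit (hφ : IsPRIR φ) (n : ℕ) :
    Submodule.span ℂ (Set.range fun x : Σ μ : Shape n, Idx n μ × Idx n μ =>
      matUnit φ x.1 x.2.1 x.2.2) = ⊤ := by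
  rw [eq_top_iff]
  rintro x -
  obtain ⟨c, hc⟩ := hφ.exists_one_eq_sum n
  rw [← mul_one x, hc, Finset.mul_sum]
  refine Submodule.sum_mem _ fun μ _ => ?_
  rw [mul_smul_comm, Finset.mul_sum]
  refine Submodule.smul_mem _ _ (Submodule.sum_mem _ fun i _ => ?_)
  rw [mul_matUnit]
  exact Submodule.sum_mem _ fun a _ => Submodule.smul_mem _ _
    (Submodule.subset_span ⟨⟨μ, a, i⟩, rfl⟩)

end Units

/-! ### The permutation representation on tensors -/

section Tensors

variable {d n : ℕ}

theorem permOp_apply (σ : Equiv.Perm (Fin n)) (x y : Fin n → Fin d) :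
    permOp d σ x y = if x = y ∘ ⇑σ⁻¹ then 1 else 0 := rfl

theorem permOp_one : permOp d (1 : Equiv.Perm (Fin n)) = 1 := by
  ext x y
  simp [permOp_apply, Matrix.one_apply]

theorem permOp_mul (σ τ : Equiv.Perm (Fin n)) : permOp d (σ * τ) = permOp d σ * permOp d τ := by
  ext x y
  simp only [permOp, Matrix.mul_apply, Matrix.of_apply, mul_ite, mul_one, mul_zero,
    Finset.sum_ite_eq', Finset.mem_univ, if_true, mul_inv_rev, Equiv.Perm.coe_mul,
    Function.comp_assoc]

theorem mul_permOp_apply (X : Op d n) (σ : Equiv.Perm (Fin n)) (x y : Fin n → Fin d) :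
    (X * permOp d σ) x y = X x (y ∘ ⇑σ⁻¹) := by
  simp [Matrix.mul_apply, permOp_apply]

theorem permOp_conjTranspose (σ : Equiv.Perm (Fin n)) :
    (permOp d σ).conjTranspose = permOp d σ⁻¹ := by
  ext x y
  rw [Matrix.conjTranspose_apply, permOp_apply, permOp_apply]
  have : y = x ∘ ⇑σ⁻¹ ↔ x = y ∘ ⇑σ⁻¹⁻¹ := by
    constructor
    · rintro rfl
      ext i
      simp
    · rintro rfl
      ext i
      simp
  simp only [this]
  split_ifs <;> simp

variable (d n) in
/-- The action of the group algebra on tensors. -/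
def permAlgHom : MonoidAlgebra ℂ (Equiv.Perm (Fin n)) →ₐ[ℂ] Op d n :=
  MonoidAlgebra.lift ℂ _ _
    { toFun := permOp d
      map_one' := permOp_one
      map_mul' := permOp_mul }

theorem permAlgHom_single (σ : Equiv.Perm (Fin n)) (c : ℂ) :
    permAlgHom d n (MonoidAlgebra.single σ c) = c • permOp d σ := by
  simp [permAlgHom]

theorem permRep_apply (σ : Equiv.Perm (Fin n)) (v : (Fin n → Fin d) → ℂ) :
    permRep d n σ v = (permOp d σ).mulVec v := by
  simp [permRep]

/-- By pigeonhole two of the more than `d` sites of colour `c` carry the same basis vector;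
exchanging them fixes `y` but reverses the sign of the antisymmetrizer. -/
theorem permAlgHom_antisymmetrizer_eq_zero {f : Fin n → ℕ} {c : ℕ}
    (h : d < (Finset.univ.filter fun j => f j = c).card) :
    permAlgHom d n (antisymmetrizer f) = 0 := by
  ext x y
  obtain ⟨i, hi, j, hj, hij, hy⟩ := Finset.exists_ne_map_eq_of_card_lt_of_maps_to
    (t := (Finset.univ : Finset (Fin d))) (by simpa using h) (f := y) (fun _ _ => Finset.mem_univ _)
  simp only [Finset.mem_filter, Finset.mem_univ, true_and] at hi hj
  have h1 := congrFun (congrFun (congrArg (permAlgHom d n)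
    (antisymmetrizer_mul_single_swap hij (hi.trans hj.symm))) x) y
  rw [map_mul, permAlgHom_single, one_smul, mul_permOp_apply, map_neg, Matrix.neg_apply] at h1
  have h2 : y ∘ ⇑(Equiv.swap i j)⁻¹ = y := by
    ext l
    simp only [Equiv.swap_inv, Function.comp_apply]
    congr 1
    rcases eq_or_ne l i with rfl | hl
    · simp [hy]
    · rcases eq_or_ne l j with rfl | hl'
      · simp [hy]
      · rw [Equiv.swap_apply_of_ne_of_ne hl hl']
  rw [h2] at h1
  exact self_eq_neg.1 h1

theorem permAlgHom_youngElement_eq_zero {μ : Shape n} (T : μ.1.cells ≃ Fin n)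
    (h : d < μ.1.colLen 0) : permAlgHom d n (youngElement T) = 0 := by
  rw [youngElement, map_mul, permAlgHom_antisymmetrizer_eq_zero (c := 0), mul_zero]
  rwa [card_colOf]

theorem permAlgHom_youngElement_ne_zero {μ : Shape n} (T : μ.1.cells ≃ Fin n)
    (h : μ.1.colLen 0 ≤ d) : permAlgHom d n (youngElement T) ≠ 0 := by
  classical
  have hlt : ∀ i, rowOf T i < d := fun i => by
    refine lt_of_lt_of_le ?_ h
    rw [← YoungDiagram.mem_iff_lt_colLen]
    exact μ.1.up_left_mem le_rfl (Nat.zero_le _) (T.symm i).2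
  -- Each site carries its row number. Row permutations fix this vector, and a nontrivial column
  -- permutation moves it off its row orbit, so the diagonal entry at `y` is the number of row
  -- permutations.
  let y : Fin n → Fin d := fun i => ⟨rowOf T i, hlt i⟩
  intro h0
  have h1 := congrFun (congrFun h0 y) y
  rw [youngElement, symmetrizer, antisymmetrizer, Finset.sum_mul_sum] at h1
  simp only [map_sum, MonoidAlgebra.single_mul_single, permAlgHom_single, one_mul,
    Matrix.sum_apply, Matrix.smul_apply, permOp_apply, Matrix.zero_apply] at h1
  have h2 : ∀ (p : Preserving (rowOf T)) (q : Preserving (colOf T)),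
      (y = y ∘ ⇑(p.1 * q.1)⁻¹) ↔ q = ⟨1, fun _ => by rw [Equiv.Perm.one_apply]⟩ := by
    intro p q
    constructor
    · intro hy
      apply Subtype.ext
      ext1 i
      refine eq_of_rowOf_colOf T ?_ (q.2 i)
      have h3 := congrFun hy (p.1 (q.1 i))
      have h4 : rowOf T (p.1 (q.1 i)) = rowOf T i := by
        simpa [y] using h3
      rw [← p.2 (q.1 i), h4]
      rfl
    · rintro rfl
      ext i
      have h3 := p.2 (p.1⁻¹ i)
      rw [show p.1 (p.1⁻¹ i) = i from p.1.apply_symm_apply i] at h3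
      simpa [y] using h3
  simp only [h2, smul_eq_mul, mul_ite, mul_one, mul_zero, Finset.sum_ite_eq', Finset.mem_univ,
    if_true, Equiv.Perm.sign_one, Units.val_one, Int.cast_one, Finset.sum_const, nsmul_eq_mul] at h1
  have : Nonempty (Preserving (rowOf T)) := ⟨⟨1, fun _ => rfl⟩⟩
  rw [Finset.card_univ, Nat.cast_eq_zero] at h1
  exact Fintype.card_ne_zero h1

/-! ### Matrix units on tensors and the multiplicities. -/

section Units

variable {φ : (n : ℕ) → (μ : Shape n) → Equiv.Perm (Fin n) →* Matrix.unitaryGroup (Idx n μ) ℂ}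

theorem opE_eq_permAlgHom (μ : Shape n) (i j : Idx n μ) :
    opE φ d μ i j = permAlgHom d n (matUnit φ μ i j) := by
  simp [opE, matUnit, permAlgHom_single]

theorem opE_conjTranspose (μ : Shape n) (i j : Idx n μ) :
    (opE φ d μ i j).conjTranspose = opE φ d μ j i := by
  rw [opE, opE, Matrix.conjTranspose_smul, Matrix.conjTranspose_sum]
  congr 1
  · simp
  · refine Fintype.sum_equiv (Equiv.inv _) _ _ fun τ => ?_
    rw [Matrix.conjTranspose_smul, permOp_conjTranspose, coe_inv_unitary]
    simp

theorem IsPRIR.opE_mul_opE (hφ : IsPRIR φ) (μ : Shape n) (i j k l : Idx n μ) :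
    opE φ d μ i j * opE φ d μ k l = if j = k then opE φ d μ i l else 0 := by
  rw [opE_eq_permAlgHom, opE_eq_permAlgHom, ← map_mul, hφ.matUnit_mul_matUnit]
  split_ifs
  · rw [opE_eq_permAlgHom]
  · simp

theorem IsPRIR.opE_mul_of_ne (hφ : IsPRIR φ) {μ ν : Shape n} (hne : μ ≠ ν)
    (i j : Idx n μ) (k l : Idx n ν) : opE φ d μ i j * opE φ d ν k l = 0 := by
  rw [opE_eq_permAlgHom, opE_eq_permAlgHom, ← map_mul, hφ.matUnit_mul_of_ne hne, map_zero]

theorem permAlgHom_mul_opE (μ : Shape n) (i j : Idx n μ)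
    (x : MonoidAlgebra ℂ (Equiv.Perm (Fin n))) :
    permAlgHom d n x * opE φ d μ i j = ∑ a, groupAlgHom (φ n μ) x a i • opE φ d μ a j := by
  simp only [opE_eq_permAlgHom, ← map_mul, mul_matUnit, map_sum, map_smul]

theorem permOp_mul_opE (μ : Shape n) (i j : Idx n μ) (g : Equiv.Perm (Fin n)) :
    permOp d g * opE φ d μ i j =
      ∑ a, (φ n μ g : Matrix (Idx n μ) (Idx n μ) ℂ) a i • opE φ d μ a j := by
  have := permAlgHom_mul_opE (d := d) (φ := φ) μ i j (MonoidAlgebra.single g 1)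
  simpa only [permAlgHom_single, groupAlgHom_single, one_smul] using this

/-- The Young symmetrizer Y vanishes on tensors but has some entry Y_{ab} ≠ 0 in `φ^μ`. Then 0 =
E_{ia} Y E_{bj} = Y_{ab} E_{ij}. -/
theorem IsPRIR.opE_eq_zero (hφ : IsPRIR φ) {μ : Shape n} (h : d < μ.1.colLen 0) (i j : Idx n μ) :
    opE φ d μ i j = 0 := by
  obtain ⟨T, hT⟩ := hφ.label n μ
  rw [← groupAlgHom_youngElement] at hT
  obtain ⟨a, b, hab⟩ : ∃ a b, groupAlgHom (φ n μ) (youngElement T) a b ≠ 0 := by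
    by_contra! h
    exact hT (Matrix.ext h)
  have h1 := permAlgHom_mul_opE (d := d) (φ := φ) μ b j (youngElement T)
  rw [permAlgHom_youngElement_eq_zero T h, zero_mul] at h1
  have h2 := congrArg (opE φ d μ i a * ·) h1
  simp only [mul_zero, Finset.mul_sum, mul_smul_comm, hφ.opE_mul_opE, smul_ite, smul_zero,
    Finset.sum_ite_eq, Finset.mem_univ, if_true] at h2
  exact (smul_eq_zero.1 h2.symm).resolve_left hab

/-- If one unit of `μ` vanished on tensors, all would. The Young symmetrizer of shape `μ` is killed
by the other irreps, so expanding it in matrix units leaves only those of `μ`, and it would vanish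
on tensors too. -/
theorem IsPRIR.opE_ne_zero (hφ : IsPRIR φ) {μ : Shape n} (h : μ.1.colLen 0 ≤ d) (i j : Idx n μ) :
    opE φ d μ i j ≠ 0 := by
  intro h0
  have hall : ∀ a b, opE φ d μ a b = 0 := by
    intro a b
    have h1 : opE φ d μ a i * opE φ d μ i j * opE φ d μ j b = opE φ d μ a b := by
      simp [hφ.opE_mul_opE]
    rw [← h1, h0]
    simp
  obtain ⟨T, -⟩ := hφ.label n μ
  apply permAlgHom_youngElement_ne_zero T h
  obtain ⟨c, hc⟩ := hφ.exists_one_eq_sum n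
  rw [← mul_one (youngElement T), hc, map_mul]
  simp only [map_sum, map_smul, ← opE_eq_permAlgHom, Finset.mul_sum, mul_smul_comm,
    permAlgHom_mul_opE]
  refine Finset.sum_eq_zero fun ν _ => ?_
  rcases eq_or_ne μ ν with rfl | hne
  · simp [hall]
  · simp [hφ.youngElement_eq_zero hne]

theorem intertwiningMap_groupAlgHom {μ : Shape n}
    (f : Representation.IntertwiningMap (matrixRep (φ n μ)) (permRep d n))
    (x : MonoidAlgebra ℂ (Equiv.Perm (Fin n))) (v : Idx n μ → ℂ) :
    f ((groupAlgHom (φ n μ) x).mulVec v) = (permAlgHom d n x).mulVec (f v) := by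
  induction x using MonoidAlgebra.induction_linear with
  | zero => simp
  | add x y hx hy => simp [Matrix.add_mulVec, hx, hy]
  | single g c =>
    have := f.isIntertwining _ _ g v
    rw [matrixRep_apply, permRep_apply] at this
    simp [groupAlgHom_single, permAlgHom_single, Matrix.smul_mulVec, this]

theorem single_mulVec_single {ι : Type*} [Fintype ι] [DecidableEq ι] (i j : ι) :
    (Matrix.single i j (1 : ℂ)).mulVec (Pi.single j 1) = Pi.single i 1 := by
  ext a
  simp [Matrix.single_apply, Pi.single_apply, eq_comm]

/-- The map sending an intertwining map to the image of the basis vector `i`. -/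
def intertwiningEval (d : ℕ) {μ : Shape n} (i : Idx n μ) :
    Representation.IntertwiningMap (matrixRep (φ n μ)) (permRep d n) →ₗ[ℂ]
      ((Fin n → Fin d) → ℂ) where
  toFun f := f (Pi.single i 1)
  map_add' _ _ := rfl
  map_smul' _ _ := rfl

theorem IsPRIR.intertwiningEval_injective (hφ : IsPRIR φ) {μ : Shape n} (i : Idx n μ) :
    Function.Injective (intertwiningEval (φ := φ) d i) := by
  intro f g h
  ext1
  ext1 a
  ext1
  have h1 : ∀ f : Representation.IntertwiningMap (matrixRep (φ n μ)) (permRep d n),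
      f (Pi.single a 1) = (opE φ d μ a i).mulVec (intertwiningEval d i f) := by
    intro f
    rw [opE_eq_permAlgHom]
    change _ = (permAlgHom d n _).mulVec (f (Pi.single i 1))
    rw [← intertwiningMap_groupAlgHom, hφ.groupAlgHom_matUnit, single_mulVec_single]
  change f (Pi.single a 1) = g (Pi.single a 1)
  rw [h1, h1, h]

/-- An intertwiner sends the basis vector e_i to a vector fixed by E_{ii}; conversely, any w yields
the intertwiner e_a ↦ E_{ai} w. With injectivity of the evaluation this identifies m_μ with the rank
of E_{ii}. -/
theorem IsPRIR.range_intertwiningEval (hφ : IsPRIR φ) {μ : Shape n} (i : Idx n μ) :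
    LinearMap.range (intertwiningEval (φ := φ) d i) =
      LinearMap.range (Matrix.toLin' (opE φ d μ i i)) := by
  ext v
  constructor
  · rintro ⟨f, rfl⟩
    refine ⟨f (Pi.single i 1), ?_⟩
    rw [Matrix.toLin'_apply, opE_eq_permAlgHom, ← intertwiningMap_groupAlgHom,
      hφ.groupAlgHom_matUnit, single_mulVec_single]
    rfl
  · rintro ⟨w, rfl⟩
    let L : (Idx n μ → ℂ) →ₗ[ℂ] ((Fin n → Fin d) → ℂ) :=
      Fintype.linearCombination ℂ (fun a => (opE φ d μ a i).mulVec w)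
    have hL : ∀ g v, L (matrixRep (φ n μ) g v) = permRep d n g (L v) := by
      intro g v
      simp only [L, Fintype.linearCombination_apply, matrixRep_apply, permRep_apply,
        Matrix.mulVec_sum, Matrix.mulVec_smul, Matrix.mulVec_mulVec, permOp_mul_opE,
        Matrix.sum_mulVec, Matrix.smul_mulVec, Finset.smul_sum]
      rw [Finset.sum_comm]
      refine Finset.sum_congr rfl fun a _ => ?_
      rw [Matrix.mulVec, dotProduct, Finset.sum_smul]
      exact Finset.sum_congr rfl fun b _ => by rw [smul_smul, mul_comm]
    refine ⟨L.intertwiningMap_of_isIntertwiningMap _ _ hL, ?_⟩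
    change L (Pi.single i 1) = _
    simp [L, Fintype.linearCombination_apply]

theorem IsPRIR.finrank_range_opE (hφ : IsPRIR φ) {μ : Shape n} (i : Idx n μ) :
    Module.finrank ℂ (LinearMap.range (Matrix.toLin' (opE φ d μ i i))) = mult φ d μ := by
  rw [← hφ.range_intertwiningEval, LinearMap.finrank_range_of_inj (hφ.intertwiningEval_injective i)]
  rfl

/-- The trace of the idempotent E_{ii} is its rank; off the diagonal, cyclicity applied to E_{ij} =
E_{ii} E_{ij} gives zero. -/
theorem IsPRIR.trace_opE (hφ : IsPRIR φ) (μ : Shape n) (i j : Idx n μ) :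
    Matrix.trace (opE φ d μ i j) = if i = j then (mult φ d μ : ℂ) else 0 := by
  split_ifs with h
  · subst h
    have hid : IsIdempotentElem (Matrix.toLin' (opE φ d μ i i)) := by
      rw [IsIdempotentElem, Module.End.mul_eq_comp, ← Matrix.toLin'_mul, hφ.opE_mul_opE, if_pos rfl]
    rw [← Matrix.trace_toLin'_eq, (LinearMap.IsIdempotentElem.isProj_range _ hid).trace,
      hφ.finrank_range_opE]
  · have h1 : opE φ d μ i j = opE φ d μ i i * opE φ d μ i j := by simp [hφ.opE_mul_opE]
    rw [h1, Matrix.trace_mul_comm, hφ.opE_mul_opE, if_neg (Ne.symm h), Matrix.trace_zero]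

theorem IsPRIR.mult_ne_zero (hφ : IsPRIR φ) {μ : Shape n} (h : μ.1.colLen 0 ≤ d)
    (i : Idx n μ) : mult φ d μ ≠ 0 := by
  intro h0
  rw [← hφ.finrank_range_opE i, Submodule.finrank_eq_zero, LinearMap.range_eq_bot] at h0
  exact hφ.opE_ne_zero h i i (Matrix.toLin'.injective (by rw [h0, map_zero]))

theorem IsPRIR.span_opE (hφ : IsPRIR φ) (d n : ℕ) :
    Submodule.span ℂ (Set.range fun x : Σ μ : Shape n, Idx n μ × Idx n μ =>
      opE φ d x.1 x.2.1 x.2.2) = Submodule.span ℂ (Set.range (permOp d (n := n))) := by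
  have h1 : Submodule.span ℂ (Set.range fun x : Σ μ : Shape n, Idx n μ × Idx n μ =>
      opE φ d x.1 x.2.1 x.2.2) = LinearMap.range (permAlgHom d n).toLinearMap := by
    rw [LinearMap.range_eq_map, ← hφ.span_matUnit n, Submodule.map_span, ← Set.range_comp]
    congr 2
    ext1 x
    exact opE_eq_permAlgHom _ _ _
  rw [h1]
  apply le_antisymm
  · rintro _ ⟨x, rfl⟩
    induction x using MonoidAlgebra.induction_linear with
    | zero => simp
    | add x y hx hy => rw [map_add]; exact Submodule.add_mem _ hx hy
    | single g c =>
      change permAlgHom d n _ ∈ _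
      rw [permAlgHom_single]
      exact Submodule.smul_mem _ _ (Submodule.subset_span ⟨g, rfl⟩)
  · rw [Submodule.span_le]
    rintro _ ⟨g, rfl⟩
    exact ⟨MonoidAlgebra.single g 1, by change permAlgHom d n _ = _; rw [permAlgHom_single, one_smul]⟩

end Units

end Tensors

/-! ### Paths and the restriction to smaller symmetric groups -/

section Restriction

variable {m : ℕ}

theorem Path.le {α : Shape m} : {k : ℕ} → {μ : Shape (m + k)} → Path α k μ → α.1 ≤ μ.1
  | 0, _, r => r.down ▸ le_rfl
  | _ + 1, _, r => (Path.le r.2).trans r.1.2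

theorem colLen_mono {μ ν : YoungDiagram} (h : μ ≤ ν) (j : ℕ) : μ.colLen j ≤ ν.colLen j := by
  by_contra! hlt
  have h1 := YoungDiagram.mem_iff_lt_colLen.2 hlt
  exact lt_irrefl _ (YoungDiagram.mem_iff_lt_colLen.1 (h h1))

theorem Path.append_injective {α : Shape m} {k : ℕ} {μ : Shape (m + k)} (r : Path α k μ) :
    Function.Injective r.append := by
  induction k with
  | zero =>
    obtain ⟨rfl⟩ := r
    exact fun _ _ h => h
  | succ k ih =>
    intro a b h
    have h1 : (⟨r.1, r.2.append a⟩ : Σ β : Below (n := m + k) μ, Idx (m + k) β.1) =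
      ⟨r.1, r.2.append b⟩ := h
    rw [Sigma.mk.injEq] at h1
    exact ih r.2 (eq_of_heq h1.2)

theorem exists_append_eq {k : ℕ} {μ : Shape (m + k)} (i : Idx (m + k) μ) :
    ∃ (α : Shape m) (r : Path α k μ) (l : Idx m α), r.append l = i := by
  induction k with
  | zero => exact ⟨μ, ⟨rfl⟩, i, rfl⟩
  | succ k ih =>
    obtain ⟨α, r, l, h⟩ := ih (μ := i.1.1) i.2
    exact ⟨α, ⟨i.1, r⟩, l, by
      change (⟨i.1, r.append l⟩ : Σ β : Below (n := m + k) μ, Idx (m + k) β.1) = i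
      rw [h]
      rfl⟩

theorem extendPerm_castAdd (n j : ℕ) (σ : Equiv.Perm (Fin n)) (i : Fin n) :
    extendPerm n j σ (Fin.castAdd j i) = Fin.castAdd j (σ i) := by
  simp [extendPerm, Equiv.permCongr_apply]

theorem extendPerm_natAdd (n j : ℕ) (σ : Equiv.Perm (Fin n)) (i : Fin j) :
    extendPerm n j σ (Fin.natAdd n i) = Fin.natAdd n i := by
  simp [extendPerm, Equiv.permCongr_apply]

theorem extendPerm_inv (n j : ℕ) (σ : Equiv.Perm (Fin n)) :
    (extendPerm n j σ)⁻¹ = extendPerm n j σ⁻¹ := by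
  rw [inv_eq_iff_mul_eq_one]
  ext1 i
  refine Fin.addCases (fun i => ?_) (fun i => ?_) i
  · simp [extendPerm_castAdd]
  · simp [extendPerm_natAdd]

theorem extendPerm_zero (n : ℕ) (σ : Equiv.Perm (Fin n)) : extendPerm n 0 σ = σ := by
  ext1 i
  exact extendPerm_castAdd n 0 σ i

theorem extendPerm_succ (n k : ℕ) (σ : Equiv.Perm (Fin n)) :
    extendPerm n (k + 1) σ = extendPerm (n + k) 1 (extendPerm n k σ) := by
  ext1 i
  refine Fin.addCases (fun i => ?_) (fun i => ?_) i
  · rw [extendPerm_castAdd]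
    have h : ∀ a : Fin n, Fin.castAdd (k + 1) a = Fin.castAdd 1 (Fin.castAdd k a) := fun a => rfl
    rw [h, h, extendPerm_castAdd, extendPerm_castAdd]
  · rw [extendPerm_natAdd]
    refine Fin.lastCases ?_ (fun a => ?_) i
    · exact (extendPerm_natAdd (n + k) 1 (extendPerm n k σ) 0).symm
    · have h : Fin.natAdd n a.castSucc = Fin.castAdd 1 (Fin.natAdd n a) := rfl
      rw [h, extendPerm_castAdd, extendPerm_natAdd]

variable {φ : (n : ℕ) → (μ : Shape n) → Equiv.Perm (Fin n) →* Matrix.unitaryGroup (Idx n μ) ℂ}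

theorem IsPRIR.extendPerm_append (hφ : IsPRIR φ) {k : ℕ} {μ : Shape (m + k)} {α : Shape m}
    (r : Path α k μ) (a b : Idx m α) (σ : Equiv.Perm (Fin m)) :
    (φ (m + k) μ (extendPerm m k σ) : Matrix _ _ ℂ) (r.append a) (r.append b) =
      (φ m α σ : Matrix _ _ ℂ) a b := by
  induction k with
  | zero =>
    obtain ⟨rfl⟩ := r
    rw [extendPerm_zero]
    rfl
  | succ k ih =>
    rw [extendPerm_succ, ← ih r.2]
    exact hφ.block_diag (m + k) μ r.1 (r.2.append a) (r.2.append b) (extendPerm m k σ)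

/-- Common top steps are peeled off by the diagonal blocks until the paths separate, where the
off-diagonal block vanishes. Paths are compared together with their end points, since these may
differ. -/
theorem IsPRIR.extendPerm_append_of_ne (hφ : IsPRIR φ) {k : ℕ} {μ : Shape (m + k)} {α β : Shape m}
    (r : Path α k μ) (s : Path β k μ)
    (h : (⟨α, r⟩ : Σ α : Shape m, Path α k μ) ≠ ⟨β, s⟩) (a : Idx m α) (b : Idx m β)
    (σ : Equiv.Perm (Fin m)) :
    (φ (m + k) μ (extendPerm m k σ) : Matrix _ _ ℂ) (r.append a) (s.append b) = 0 := by
  induction k with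
  | zero =>
    obtain ⟨rfl⟩ := r
    obtain ⟨rfl⟩ := s
    exact absurd rfl h
  | succ k ih =>
    rw [extendPerm_succ]
    obtain ⟨γ, r⟩ := r
    obtain ⟨δ, s⟩ := s
    by_cases hγ : γ = δ
    · subst hγ
      have h1 := ih r s (by
        intro h1
        apply h
        cases h1
        rfl)
      rw [← h1]
      exact hφ.block_diag (m + k) μ γ (r.append a) (s.append b) (extendPerm m k σ)
    · exact hφ.block_off (m + k) μ γ δ (r.append a) (s.append b) (extendPerm m k σ) hγ

end Restriction

/-! ### Tensoring with the identity and the partial trace -/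

section PartialTrace

variable {d n j : ℕ}

theorem sum_append (f : (Fin (n + j) → Fin d) → ℂ) :
    ∑ z, f z = ∑ x : Fin n → Fin d, ∑ c : Fin j → Fin d, f (Fin.append x c) := by
  rw [← Fintype.sum_prod_type' (f := fun x c => f (Fin.append x c))]
  exact (Fintype.sum_equiv (Fin.appendEquiv n j) _ _ fun _ => rfl).symm

theorem append_comp_castAdd (x : Fin n → Fin d) (c : Fin j → Fin d) :
    Fin.append x c ∘ Fin.castAdd j = x := by
  ext i
  simp

theorem append_comp_natAdd (x : Fin n → Fin d) (c : Fin j → Fin d) :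
    Fin.append x c ∘ Fin.natAdd n = c := by
  ext i
  simp

theorem exists_eq_append (x : Fin (n + j) → Fin d) : ∃ u c, x = Fin.append u c :=
  ⟨fun i => x (Fin.castAdd j i), fun i => x (Fin.natAdd n i), (Fin.append_castAdd_natAdd).symm⟩

theorem append_eq_append_iff {x y : Fin n → Fin d} {c e : Fin j → Fin d} :
    Fin.append x c = Fin.append y e ↔ x = y ∧ c = e :=
  ⟨fun h => ⟨by rw [← append_comp_castAdd x c, h, append_comp_castAdd],
    by rw [← append_comp_natAdd x c, h, append_comp_natAdd]⟩, by rintro ⟨rfl, rfl⟩; rfl⟩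

theorem tensorOne_append (X : Op d n) (x y : Fin n → Fin d) (c e : Fin j → Fin d) :
    tensorOne j X (Fin.append x c) (Fin.append y e) = X x y * if c = e then 1 else 0 := by
  simp only [tensorOne, Matrix.of_apply, append_comp_castAdd, append_comp_natAdd]

variable (d n j) in
/-- `X ↦ X ⊗ 1` as a linear map. -/
def tensorOneₗ : Op d n →ₗ[ℂ] Op d (n + j) where
  toFun := tensorOne j
  map_add' X Y := by
    ext x y
    exact add_mul _ _ _
  map_smul' c X := by
    ext x y
    simp [tensorOne]

theorem tensorOneₗ_apply (X : Op d n) : tensorOneₗ d n j X = tensorOne j X := rfl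

theorem tensorOne_mul (X Y : Op d n) : tensorOne j (X * Y) = tensorOne j X * tensorOne j Y := by
  ext x y
  obtain ⟨x, c, rfl⟩ := exists_eq_append x
  obtain ⟨y, e, rfl⟩ := exists_eq_append y
  rw [Matrix.mul_apply, sum_append, tensorOne_append, Matrix.mul_apply, Finset.sum_mul]
  refine Finset.sum_congr rfl fun z _ => ?_
  simp only [tensorOne_append]
  rw [Finset.sum_eq_single c]
  · simp
  · intro b _ hb
    simp [hb.symm]
  · simp

theorem tensorOne_one : tensorOne j (1 : Op d n) = 1 := by
  ext x y
  obtain ⟨x, c, rfl⟩ := exists_eq_append x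
  obtain ⟨y, e, rfl⟩ := exists_eq_append y
  rw [tensorOne_append, Matrix.one_apply, Matrix.one_apply]
  simp only [append_eq_append_iff]
  split_ifs <;> simp_all

theorem tensorOne_smul (c : ℂ) (X : Op d n) : tensorOne j (c • X) = c • tensorOne j X :=
  (tensorOneₗ d n j).map_smul c X

theorem tensorOne_zero : tensorOne j (0 : Op d n) = 0 := (tensorOneₗ d n j).map_zero

theorem tensorOne_conjTranspose (X : Op d n) :
    (tensorOne j X).conjTranspose = tensorOne j X.conjTranspose := by
  ext x y
  simp only [tensorOne, Matrix.conjTranspose_apply, Matrix.of_apply, star_mul', eq_comm]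
  split_ifs <;> simp

theorem append_comp_extendPerm (x : Fin n → Fin d) (c : Fin j → Fin d) (σ : Equiv.Perm (Fin n)) :
    Fin.append x c ∘ ⇑(extendPerm n j σ) = Fin.append (x ∘ σ) c := by
  ext1 i
  refine Fin.addCases (fun i => ?_) (fun i => ?_) i
  · simp [extendPerm_castAdd]
  · simp [extendPerm_natAdd]

theorem tensorOne_permOp (σ : Equiv.Perm (Fin n)) :
    tensorOne j (permOp d σ) = permOp d (extendPerm n j σ) := by
  ext x y
  obtain ⟨x, c, rfl⟩ := exists_eq_append x
  obtain ⟨y, e, rfl⟩ := exists_eq_append y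
  rw [tensorOne_append, permOp_apply, permOp_apply, extendPerm_inv, append_comp_extendPerm]
  simp only [append_eq_append_iff]
  split_ifs <;> simp_all

/-- The partial trace over the last `j` subsystems. -/
def partialTrace (d n j : ℕ) : Op d (n + j) →ₗ[ℂ] Op d n where
  toFun X := Matrix.of fun x y => ∑ c : Fin j → Fin d, X (Fin.append x c) (Fin.append y c)
  map_add' X Y := by
    ext x y
    simp [Finset.sum_add_distrib]
  map_smul' c X := by
    ext x y
    simp [Finset.mul_sum]

theorem partialTrace_apply (X : Op d (n + j)) (x y : Fin n → Fin d) :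
    partialTrace d n j X x y = ∑ c : Fin j → Fin d, X (Fin.append x c) (Fin.append y c) := rfl

theorem trace_partialTrace (X : Op d (n + j)) :
    Matrix.trace (partialTrace d n j X) = Matrix.trace X := by
  simp only [Matrix.trace, Matrix.diag_apply, partialTrace_apply]
  rw [sum_append]

theorem partialTrace_tensorOne_mul (A : Op d n) (X : Op d (n + j)) :
    partialTrace d n j (tensorOne j A * X) = A * partialTrace d n j X := by
  ext x y
  simp only [partialTrace_apply, Matrix.mul_apply, sum_append, tensorOne_append, Finset.mul_sum]
  rw [Finset.sum_comm]
  refine Finset.sum_congr rfl fun z _ => Finset.sum_congr rfl fun c _ => ?_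
  simp

theorem partialTrace_mul_tensorOne (A : Op d n) (X : Op d (n + j)) :
    partialTrace d n j (X * tensorOne j A) = partialTrace d n j X * A := by
  ext x y
  simp only [partialTrace_apply, Matrix.mul_apply, sum_append, tensorOne_append, Finset.sum_mul]
  rw [Finset.sum_comm]
  refine Finset.sum_congr rfl fun z _ => Finset.sum_congr rfl fun c _ => ?_
  simp

theorem exists_extendPerm_eq (σ : Equiv.Perm (Fin (n + 1))) (h : σ (Fin.last n) = Fin.last n) :
    ∃ τ, σ = extendPerm n 1 τ := by
  have h1 : Set.MapsTo (finSumFinEquiv.symm.permCongr σ) (Set.range (Sum.inl : Fin n → Fin n ⊕ Fin 1))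
      (Set.range Sum.inl) := by
    rintro _ ⟨i, rfl⟩
    have h2 : σ (Fin.castAdd 1 i) ≠ Fin.last n := by
      rw [← h]
      exact σ.injective.ne (Fin.castSucc_lt_last i).ne
    obtain ⟨l, hl⟩ := Fin.exists_castSucc_eq.2 h2
    refine ⟨l, ?_⟩
    rw [Equiv.permCongr_apply, Equiv.symm_symm, finSumFinEquiv_apply_left, ← hl]
    exact (finSumFinEquiv_symm_apply_castAdd l).symm
  obtain ⟨⟨τ, υ⟩, hτ⟩ := Equiv.Perm.mem_sumCongrHom_range_of_perm_mapsTo_inl h1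
  refine ⟨τ, ?_⟩
  have hυ : υ = 1 := Subsingleton.elim _ _
  subst hυ
  rw [extendPerm]
  have h3 : Equiv.Perm.sumCongr τ 1 = finSumFinEquiv.symm.permCongr σ := hτ
  rw [h3]
  ext1 i
  simp [Equiv.permCongr_apply]

theorem partialTrace_swap_last (i : Fin n) :
    partialTrace d n 1 (permOp d (Equiv.swap i.castSucc (Fin.last n))) = 1 := by
  ext x y
  rw [partialTrace_apply, Matrix.one_apply]
  have h : ∀ c : Fin 1 → Fin d, Fin.append x c =
      Fin.append y c ∘ ⇑(Equiv.swap i.castSucc (Fin.last n))⁻¹ ↔ (x = y ∧ c = fun _ => y i) := by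
    intro c
    have hl : ∀ z : Fin n → Fin d, Fin.append z c (Fin.last n) = c 0 := fun z =>
      Fin.append_right z c 0
    have hc : ∀ (z : Fin n → Fin d) (l : Fin n), Fin.append z c l.castSucc = z l := fun z l =>
      Fin.append_left z c l
    constructor
    · intro h
      have h1 : c 0 = y i := by
        have := congrFun h (Fin.last n)
        simpa [hl, hc] using this
      have h2 : ∀ l, x l = y l := by
        intro l
        have := congrFun h l.castSucc
        rcases eq_or_ne l i with rfl | hne
        · simpa [hl, hc, h1] using this
        · rw [Equiv.swap_inv, Function.comp_apply, Equiv.swap_apply_of_ne_of_ne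
            (by simpa using hne) (Fin.castSucc_lt_last l).ne] at this
          simpa [hc] using this
      exact ⟨funext h2, funext fun a => by rw [Subsingleton.elim a 0, h1]⟩
    · rintro ⟨rfl, rfl⟩
      ext1 l
      rw [Equiv.swap_inv, Function.comp_apply]
      refine Fin.lastCases ?_ (fun l => ?_) l
      · simp [hl, hc]
      · rcases eq_or_ne l i with rfl | hne
        · simp [hl, hc]
        · rw [Equiv.swap_apply_of_ne_of_ne (by simpa using hne) (Fin.castSucc_lt_last l).ne]
  simp only [permOp_apply, h]
  by_cases hxy : x = y <;> simp [hxy]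

/-- Every permutation is a transposition (σ(last) last) times one fixing the last point. The latter
leaves the partial trace as a factor, and what remains is 1, or d · 1 if the transposition is
trivial. -/
theorem partialTrace_one_mem (X : Op d (n + 1))
    (hX : X ∈ Submodule.span ℂ (Set.range (permOp d (n := n + 1)))) :
    partialTrace d n 1 X ∈ Submodule.span ℂ (Set.range (permOp d (n := n))) := by
  induction hX using Submodule.span_induction with
  | zero => simp
  | add x y _ _ hx hy => rw [map_add]; exact Submodule.add_mem _ hx hy
  | smul c x _ hx => rw [map_smul]; exact Submodule.smul_mem _ _ hx
  | mem x hx =>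
    obtain ⟨σ, rfl⟩ := hx
    obtain ⟨τ, hτ⟩ := exists_extendPerm_eq (Equiv.swap (σ (Fin.last n)) (Fin.last n) * σ) (by simp)
    have h1 : σ = Equiv.swap (σ (Fin.last n)) (Fin.last n) * extendPerm n 1 τ := by
      rw [← hτ, ← mul_assoc, Equiv.swap_mul_self, one_mul]
    rw [h1, permOp_mul, ← tensorOne_permOp, partialTrace_mul_tensorOne]
    generalize σ (Fin.last n) = i
    refine Fin.lastCases ?_ (fun i => ?_) i
    · have h2 : partialTrace d n 1 (1 : Op d (n + 1)) = (d : ℂ) • 1 := by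
        rw [← tensorOne_one]
        ext x y
        simp [partialTrace_apply, tensorOne_append]
      rw [Equiv.swap_self]
      change partialTrace d n 1 (permOp d 1) * _ ∈ _
      rw [permOp_one, h2, smul_mul_assoc, one_mul]
      exact Submodule.smul_mem _ _ (Submodule.subset_span ⟨τ, rfl⟩)
    · rw [partialTrace_swap_last, one_mul]
      exact Submodule.subset_span ⟨τ, rfl⟩

theorem partialTrace_succ (X : Op d (n + (j + 1))) :
    partialTrace d n (j + 1) X = partialTrace d n j (partialTrace d (n + j) 1 X) := by
  ext x y
  simp only [partialTrace_apply]
  rw [sum_append]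
  refine Finset.sum_congr rfl fun c _ => Finset.sum_congr rfl fun e _ => ?_
  rw [Fin.append_assoc, Fin.append_assoc]
  rfl

theorem partialTrace_mem (X : Op d (n + j))
    (hX : X ∈ Submodule.span ℂ (Set.range (permOp d (n := n + j)))) :
    partialTrace d n j X ∈ Submodule.span ℂ (Set.range (permOp d (n := n))) := by
  induction j with
  | zero =>
    have h : partialTrace d n 0 X = X := by
      ext x y
      have h1 : ∀ (z : Fin n → Fin d) (c : Fin 0 → Fin d), Fin.append z c = z := fun z c =>
        funext fun i => Fin.append_left z c i
      rw [partialTrace_apply, Fintype.sum_unique, h1, h1]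
    rw [h]
    exact hX
  | succ j ih =>
    rw [partialTrace_succ]
    exact ih _ (partialTrace_one_mem _ hX)

end PartialTrace

/-! ### Partial traces of the matrix units -/

section

variable {d m k : ℕ} {φ : (n : ℕ) → (μ : Shape n) → Equiv.Perm (Fin n) →* Matrix.unitaryGroup (Idx n μ) ℂ}

theorem Path.append_left_injective {α : Shape m} {k : ℕ} {μ : Shape (m + k)} (r s : Path α k μ)
    (l l' : Idx m α) (h : r.append l = s.append l') : r = s := by
  induction k with
  | zero =>
    obtain ⟨rfl⟩ := r
    rfl
  | succ k ih =>
    obtain ⟨β, r⟩ := r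
    obtain ⟨γ, s⟩ := s
    have h1 : (⟨β, r.append l⟩ : Σ β : Below (n := m + k) μ, Idx (m + k) β.1) =
      ⟨γ, s.append l'⟩ := h
    rw [Sigma.mk.injEq] at h1
    obtain ⟨rfl, h2⟩ := h1
    rw [ih r s (eq_of_heq h2)]

/-- Here the block form is used: the smaller symmetric group keeps the path `r` and acts on the tail
index alone, through `φ^α`. -/
theorem IsPRIR.tensorOne_permAlgHom_mul_opE (hφ : IsPRIR φ) {μ : Shape (m + k)} {α : Shape m}
    (r : Path α k μ) (l : Idx m α) (j : Idx (m + k) μ)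
    (x : MonoidAlgebra ℂ (Equiv.Perm (Fin m))) :
    tensorOne k (permAlgHom d m x) * opE φ d μ (r.append l) j =
      ∑ c, groupAlgHom (φ m α) x c l • opE φ d μ (r.append c) j := by
  induction x using MonoidAlgebra.induction_linear with
  | zero => simp [tensorOne_zero]
  | add x y hx hy =>
    rw [map_add, ← tensorOneₗ_apply, map_add, tensorOneₗ_apply, tensorOneₗ_apply, add_mul, hx, hy]
    simp [add_smul, Finset.sum_add_distrib]
  | single g c =>
    rw [permAlgHom_single, tensorOne_smul, smul_mul_assoc, tensorOne_permOp, permOp_mul_opE,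
      groupAlgHom_single]
    simp only [Matrix.smul_apply, smul_assoc, ← Finset.smul_sum]
    congr 1
    symm
    refine Finset.sum_of_injOn r.append r.append_injective.injOn (fun _ _ => Finset.mem_univ _)
      ?_ ?_
    · intro i _ hi
      obtain ⟨β, s, b, rfl⟩ := exists_append_eq i
      rw [hφ.extendPerm_append_of_ne, zero_smul]
      intro h
      cases h
      exact hi ⟨b, by simp, rfl⟩
    · intro c _
      rw [hφ.extendPerm_append]

theorem IsPRIR.tensorOne_opE_mul_opE (hφ : IsPRIR φ) {μ : Shape (m + k)} {α : Shape m}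
    (r : Path α k μ) (a b l : Idx m α) (j : Idx (m + k) μ) :
    tensorOne k (opE φ d α a b) * opE φ d μ (r.append l) j =
      if b = l then opE φ d μ (r.append a) j else 0 := by
  rw [opE_eq_permAlgHom, hφ.tensorOne_permAlgHom_mul_opE, hφ.groupAlgHom_matUnit,
    Finset.sum_eq_single a]
  · simp only [Matrix.single_apply, true_and, ite_smul, one_smul, zero_smul]
  · intro c _ hc
    simp [hc.symm]
  · simp

theorem IsPRIR.tensorOne_opE_mul_opE_of_ne (hφ : IsPRIR φ) {μ : Shape (m + k)} {α β : Shape m}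
    (hne : α ≠ β) (r : Path β k μ) (a b : Idx m α) (l : Idx m β) (j : Idx (m + k) μ) :
    tensorOne k (opE φ d α a b) * opE φ d μ (r.append l) j = 0 := by
  rw [opE_eq_permAlgHom, hφ.tensorOne_permAlgHom_mul_opE, hφ.groupAlgHom_matUnit_of_ne hne]
  simp

theorem IsPRIR.opE_mul_tensorOne_opE (hφ : IsPRIR φ) {μ : Shape (m + k)} {α : Shape m}
    (r : Path α k μ) (a b l : Idx m α) (i : Idx (m + k) μ) :
    opE φ d μ i (r.append l) * tensorOne k (opE φ d α a b) =
      if l = a then opE φ d μ i (r.append b) else 0 := by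
  rw [← Matrix.conjTranspose_inj, Matrix.conjTranspose_mul, tensorOne_conjTranspose,
    opE_conjTranspose, opE_conjTranspose, hφ.tensorOne_opE_mul_opE]
  simp only [eq_comm (a := a)]
  split_ifs <;> simp [opE_conjTranspose]

/-- Between two primitive idempotents of one block of matrix units only a line survives. -/
theorem IsPRIR.opE_mul_mul_opE_mem_span (hφ : IsPRIR φ) {n : ℕ} (α : Shape n) (l l' : Idx n α)
    {Z : Op d n} (hZ : Z ∈ Submodule.span ℂ (Set.range (permOp d (n := n)))) :
    ∃ c : ℂ, opE φ d α l l * Z * opE φ d α l' l' = c • opE φ d α l l' := by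
  rw [← hφ.span_opE] at hZ
  induction hZ using Submodule.span_induction with
  | zero => exact ⟨0, by simp⟩
  | add x y _ _ hx hy =>
    obtain ⟨a, ha⟩ := hx
    obtain ⟨b, hb⟩ := hy
    exact ⟨a + b, by rw [mul_add, add_mul, ha, hb, add_smul]⟩
  | smul a x _ hx =>
    obtain ⟨b, hb⟩ := hx
    exact ⟨a * b, by rw [mul_smul_comm, smul_mul_assoc, hb, smul_smul]⟩
  | mem x hx =>
    obtain ⟨⟨β, i, j⟩, rfl⟩ := hx
    rcases eq_or_ne α β with rfl | hne
    · by_cases h1 : l = i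
      · by_cases h2 : j = l'
        · exact ⟨1, by simp [hφ.opE_mul_opE, h1, h2]⟩
        · exact ⟨0, by simp [hφ.opE_mul_opE, h1, h2]⟩
      · exact ⟨0, by simp [hφ.opE_mul_opE, h1]⟩
    · exact ⟨0, by simp [hφ.opE_mul_of_ne hne]⟩

theorem IsPRIR.opE_mul_mul_opE_of_ne (hφ : IsPRIR φ) {n : ℕ} {α β : Shape n} (hne : α ≠ β)
    (l : Idx n α) (l' : Idx n β)
    {Z : Op d n} (hZ : Z ∈ Submodule.span ℂ (Set.range (permOp d (n := n)))) :
    opE φ d α l l * Z * opE φ d β l' l' = 0 := by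
  rw [← hφ.span_opE] at hZ
  induction hZ using Submodule.span_induction with
  | zero => simp
  | add x y _ _ hx hy => rw [mul_add, add_mul, hx, hy, add_zero]
  | smul a x _ hx => rw [mul_smul_comm, smul_mul_assoc, hx, smul_zero]
  | mem x hx =>
    obtain ⟨⟨γ, i, j⟩, rfl⟩ := hx
    rcases eq_or_ne α γ with rfl | hne'
    · rw [mul_assoc, hφ.opE_mul_of_ne hne, mul_zero]
    · rw [hφ.opE_mul_of_ne hne', zero_mul]

theorem IsPRIR.opE_mem_span (hφ : IsPRIR φ) {n : ℕ} (μ : Shape n) (i j : Idx n μ) :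
    opE φ d μ i j ∈ Submodule.span ℂ (Set.range (permOp d (n := n))) := by
  rw [← hφ.span_opE]
  exact Submodule.subset_span ⟨⟨μ, i, j⟩, rfl⟩

/-- The unit absorbs E^α_{ll} ⊗ 1 and E^β_{l'l'} ⊗ 1, and the partial trace is a bimodule map over
operators on the first `m` subsystems. -/
theorem IsPRIR.partialTrace_opE_sandwich (hφ : IsPRIR φ) {μ : Shape (m + k)} {α β : Shape m}
    (r : Path α k μ) (s : Path β k μ) (l : Idx m α) (l' : Idx m β) :
    opE φ d α l l * partialTrace d m k (opE φ d μ (r.append l) (s.append l')) * opE φ d β l' l' =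
      partialTrace d m k (opE φ d μ (r.append l) (s.append l')) := by
  rw [← partialTrace_tensorOne_mul, ← partialTrace_mul_tensorOne, hφ.tensorOne_opE_mul_opE,
    if_pos rfl, hφ.opE_mul_tensorOne_opE, if_pos rfl]

theorem IsPRIR.partialTrace_opE_of_ne (hφ : IsPRIR φ) {μ : Shape (m + k)} {α β : Shape m}
    (hne : α ≠ β) (r : Path α k μ) (s : Path β k μ) (l : Idx m α) (l' : Idx m β) :
    partialTrace d m k (opE φ d μ (r.append l) (s.append l')) = 0 := by
  rw [← hφ.partialTrace_opE_sandwich]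
  exact hφ.opE_mul_mul_opE_of_ne hne _ _ (partialTrace_mem _ (hφ.opE_mem_span _ _ _))

-- The partial trace lies in the span of permutations and is sandwiched between primitive
-- idempotents, so it is a multiple of E^α_{ll'}. Multiplying by E^α_{l'l} and taking the full trace
-- gives m_μ δ_{rs} = c m_α, which fixes the multiple.
open Classical in
theorem IsPRIR.partialTrace_opE (hφ : IsPRIR φ) {μ : Shape (m + k)} {α : Shape m}
    (hα : α.1.colLen 0 ≤ d) (r s : Path α k μ) (l l' : Idx m α) :
    partialTrace d m k (opE φ d μ (r.append l) (s.append l')) =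
      if r = s then ((mult φ d μ : ℂ) / mult φ d α) • opE φ d α l l' else 0 := by
  have hm : (mult φ d α : ℂ) ≠ 0 := by exact_mod_cast hφ.mult_ne_zero hα l
  obtain ⟨c, hc⟩ := hφ.opE_mul_mul_opE_mem_span α l l'
    (partialTrace_mem (j := k) _ (hφ.opE_mem_span (d := d) μ (r.append l) (s.append l')))
  rw [hφ.partialTrace_opE_sandwich] at hc
  have h1 := congrArg (fun X => Matrix.trace (X * opE φ d α l' l)) hc
  simp only [← partialTrace_mul_tensorOne, hφ.opE_mul_tensorOne_opE, if_true, trace_partialTrace,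
    smul_mul_assoc, hφ.opE_mul_opE, Matrix.trace_smul, hφ.trace_opE, smul_eq_mul] at h1
  rw [hc]
  split_ifs with hrs
  · subst hrs
    rw [if_pos rfl] at h1
    rw [h1, mul_div_cancel_right₀ _ hm]
  · rw [if_neg fun h => hrs (Path.append_left_injective r s l l h)] at h1
    rw [(mul_eq_zero.1 h1.symm).resolve_right hm, zero_smul]

end

/-! ### The contraction operator -/

section Contraction

variable {d m k : ℕ}

/-- The basis vector `|u c c'⟩`, where `c'` is `c` in reverse order. -/
def arcState (u : Fin m → Fin d) (c : Fin k → Fin d) : Fin (m + k + k) → Fin d :=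
  Fin.append (Fin.append u c) (c ∘ Fin.rev)

theorem arcState_injective {u v : Fin m → Fin d} {c e : Fin k → Fin d} :
    arcState u c = arcState v e ↔ u = v ∧ c = e := by
  rw [arcState, arcState, append_eq_append_iff, append_eq_append_iff]
  exact ⟨fun h => h.1, by rintro ⟨rfl, rfl⟩; exact ⟨⟨rfl, rfl⟩, rfl⟩⟩

open Classical in
/-- The (unnormalized) maximally entangled state on the last `2k` subsystems, tensored with the
identity on the first `m`. -/
def arcs (d m k : ℕ) : Matrix (Fin (m + k + k) → Fin d) (Fin m → Fin d) ℂ :=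
  Matrix.of fun x u => if ∃ c : Fin k → Fin d, x = arcState u c then 1 else 0

theorem mul_arcs_apply {ι : Type*} (M : Matrix ι (Fin (m + k + k) → Fin d) ℂ) (x : ι)
    (u : Fin m → Fin d) : (M * arcs d m k) x u = ∑ c : Fin k → Fin d, M x (arcState u c) := by
  classical
  rw [Matrix.mul_apply]
  symm
  refine Finset.sum_of_injOn (arcState u) ?_ (fun _ _ => Finset.mem_univ _) ?_ ?_
  · intro a _ b _ h
    exact (arcState_injective.1 h).2
  · intro z _ hz
    rw [arcs, Matrix.of_apply, if_neg, mul_zero]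
    rintro ⟨c, rfl⟩
    exact hz ⟨c, by simp, rfl⟩
  · intro c _
    rw [arcs, Matrix.of_apply, if_pos ⟨c, rfl⟩, mul_one]

theorem arcs_append (x : Fin (m + k) → Fin d) (c : Fin k → Fin d) (u : Fin m → Fin d) :
    arcs d m k (Fin.append x c) u = if x = Fin.append u (c ∘ Fin.rev) then 1 else 0 := by
  rw [arcs, Matrix.of_apply]
  congr 1
  apply propext
  constructor
  · rintro ⟨e, he⟩
    rw [arcState, append_eq_append_iff] at he
    obtain ⟨rfl, rfl⟩ := he
    congr 1
    ext i
    simp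
  · rintro rfl
    refine ⟨c ∘ Fin.rev, ?_⟩
    rw [arcState]
    congr 1
    ext i
    simp

theorem tensorOne_mul_arcs_apply (X : Op d (m + k)) (x : Fin (m + k) → Fin d) (c : Fin k → Fin d)
    (u : Fin m → Fin d) :
    (tensorOne k X * arcs d m k) (Fin.append x c) u = X x (Fin.append u (c ∘ Fin.rev)) := by
  rw [mul_arcs_apply, Finset.sum_eq_single (c ∘ Fin.rev)]
  · rw [arcState, tensorOne_append, if_pos, mul_one]
    ext i
    simp
  · intro e _ he
    rw [arcState, tensorOne_append, if_neg, mul_zero]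
    rintro rfl
    apply he
    ext i
    simp
  · simp

/-- The far end of each arc is untouched by X ⊗ 1, so it forces equal row and column values on the
near end, and summing over them is the partial trace. -/
theorem conjTranspose_arcs_mul_tensorOne_mul_arcs (X : Op d (m + k)) :
    (arcs d m k).conjTranspose * (tensorOne k X * arcs d m k) = partialTrace d m k X := by
  ext u v
  rw [← Matrix.conjTranspose_conjTranspose (tensorOne k X * arcs d m k),
    ← Matrix.conjTranspose_mul, Matrix.conjTranspose_apply, mul_arcs_apply, partialTrace_apply,
    star_sum]
  refine Finset.sum_congr rfl fun c _ => ?_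
  rw [Matrix.conjTranspose_apply, star_star, arcState, tensorOne_mul_arcs_apply]
  congr 2
  ext i
  simp

theorem tensorOne_tensorOne_mul_arcs (A : Op d m) :
    tensorOne k (tensorOne k A) * arcs d m k = arcs d m k * A := by
  ext x u
  obtain ⟨x, c, rfl⟩ := exists_eq_append x
  obtain ⟨x, e, rfl⟩ := exists_eq_append x
  rw [tensorOne_mul_arcs_apply, tensorOne_append, Matrix.mul_apply]
  simp only [arcs_append, append_eq_append_iff]
  by_cases h : e = c ∘ Fin.rev <;> simp [h]

/-- The involution of the subsystems exchanging the end points of the arcs. -/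
def arcMap (m k : ℕ) : Fin (m + k + k) → Fin (m + k + k) :=
  Fin.addCases
    (Fin.addCases (fun a => Fin.castAdd k (Fin.castAdd k a)) fun j => Fin.natAdd (m + k) j.rev)
    fun j => Fin.castAdd k (Fin.natAdd m j.rev)

theorem arcMap_involutive (m k : ℕ) : Function.Involutive (arcMap m k) := by
  intro i
  refine Fin.addCases (fun i => ?_) (fun j => ?_) i
  · refine Fin.addCases (fun i => ?_) (fun j => ?_) i
    · simp [arcMap]
    · simp [arcMap]
  · simp [arcMap]

/-- The permutation exchanging the end points of the arcs. -/
def arcPerm (m k : ℕ) : Equiv.Perm (Fin (m + k + k)) := (arcMap_involutive m k).toPerm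

theorem arcPerm_inv : (arcPerm m k)⁻¹ = arcPerm m k := Function.Involutive.toPerm_symm _

theorem append_comp_arcPerm (u : Fin m → Fin d) (c e : Fin k → Fin d) :
    Fin.append (Fin.append u c) e ∘ ⇑(arcPerm m k) =
      Fin.append (Fin.append u (e ∘ Fin.rev)) (c ∘ Fin.rev) := by
  change _ ∘ arcMap m k = _
  ext1 i
  refine Fin.addCases (fun i => ?_) (fun j => ?_) i
  · refine Fin.addCases (fun i => ?_) (fun j => ?_) i
    · simp [arcMap]
    · simp [arcMap]
  · simp [arcMap]

theorem mem_lastSystems_natAdd (N k : ℕ) (i : Fin k) : Fin.natAdd N i ∈ lastSystems N k := by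
  simp [lastSystems]

theorem notMem_lastSystems_castAdd (N k : ℕ) (i : Fin N) : Fin.castAdd k i ∉ lastSystems N k := by
  simp only [lastSystems, Finset.mem_image, Finset.mem_univ, true_and, not_exists]
  intro j hj
  have := congrArg Fin.val hj
  simp only [Fin.val_natAdd, Fin.val_castAdd] at this
  omega

theorem partialTranspose_lastSystems_append {N : ℕ} (X : Op d (N + k)) (x y : Fin N → Fin d)
    (c e : Fin k → Fin d) :
    partialTranspose (lastSystems N k) X (Fin.append x c) (Fin.append y e) =
      X (Fin.append x e) (Fin.append y c) := by
  have h : ∀ (z z' : Fin N → Fin d) (a b : Fin k → Fin d),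
      (fun i => if i ∈ lastSystems N k then Fin.append z' b i else Fin.append z a i) =
        Fin.append z b := by
    intro z z' a b
    ext1 i
    refine Fin.addCases (fun i => ?_) (fun j => ?_) i
    · simp [notMem_lastSystems_castAdd]
    · simp [mem_lastSystems_natAdd]
  rw [partialTranspose, Matrix.of_apply, h, h]

/-- With `contractionOp_eq` this exhibits V^{(k)} as a single generator of the algebra. -/
theorem partialTranspose_arcPerm :
    partialTranspose (lastSystems (m + k) k) (permOp d (arcPerm m k)) =
      arcs d m k * (arcs d m k).conjTranspose := by
  ext x y
  obtain ⟨x, c, rfl⟩ := exists_eq_append x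
  obtain ⟨x, a, rfl⟩ := exists_eq_append x
  obtain ⟨y, e, rfl⟩ := exists_eq_append y
  obtain ⟨y, b, rfl⟩ := exists_eq_append y
  rw [partialTranspose_lastSystems_append, permOp_apply, arcPerm_inv, append_comp_arcPerm]
  simp only [Matrix.mul_apply, Matrix.conjTranspose_apply, arcs_append, append_eq_append_iff]
  have h : e = b ∘ Fin.rev ↔ b = e ∘ Fin.rev := by
    constructor
    · rintro rfl
      ext i
      simp
    · rintro rfl
      ext i
      simp
  simp only [h]
  by_cases h1 : a = c ∘ Fin.rev <;> by_cases h2 : b = e ∘ Fin.rev <;> simp [h1, h2]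

/-- A partially transposed operator acts on the arcs as an operator on the first `m + k`
subsystems. -/
theorem partialTranspose_mul_arcs (X : Op d (m + k + k)) :
    partialTranspose (lastSystems (m + k) k) X * arcs d m k =
      tensorOne k (partialTrace d (m + k) k (X * permOp d (arcPerm m k))) * arcs d m k := by
  ext x u
  obtain ⟨x, c, rfl⟩ := exists_eq_append x
  rw [tensorOne_mul_arcs_apply, mul_arcs_apply, partialTrace_apply]
  refine Fintype.sum_equiv (Equiv.arrowCongr Fin.revPerm (Equiv.refl _)) _ _ fun e => ?_
  rw [mul_permOp_apply, arcPerm_inv, append_comp_arcPerm, arcState,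
    partialTranspose_lastSystems_append]
  congr 2
  · congr 1
    ext i
    simp
  · ext i
    simp

end Contraction

/-! ### The contraction operator in terms of the arcs -/

section ContractionOp

theorem indicator_mul_indicator (P Q : Prop) [Decidable P] [Decidable Q] [Decidable (P ∧ Q)] :
    (if P then (1 : ℂ) else 0) * (if Q then 1 else 0) = if P ∧ Q then 1 else 0 := by
  split_ifs <;> simp_all

theorem partialTranspose_swap_apply {d n : ℕ} {a b : Fin n} (hab : a ≠ b) (x y : Fin n → Fin d) :
    partialTranspose {b} (permOp d (Equiv.swap a b)) x y =
      if x a = x b ∧ y a = y b ∧ ∀ i, i ≠ a → i ≠ b → x i = y i then 1 else 0 := by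
  rw [partialTranspose, Matrix.of_apply, permOp_apply, Equiv.swap_inv]
  congr 1
  apply propext
  constructor
  · intro h
    refine ⟨?_, ?_, fun i hi hi' => ?_⟩
    · have := congrFun h a
      simpa [hab] using this
    · have := congrFun h b
      simpa [hab, eq_comm] using this
    · have := congrFun h i
      simpa [hi', Equiv.swap_apply_of_ne_of_ne hi hi'] using this
  · rintro ⟨h1, h2, h3⟩
    ext1 i
    by_cases ha : i = a
    · subst ha
      simp [hab, h1]
    · by_cases hb : i = b
      · subst hb
        simp [hab, h2]
      · simp [hb, Equiv.swap_apply_of_ne_of_ne ha hb, h3 i ha hb]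

theorem prod_partialTranspose_swap_apply {ι : Type*} {d n : ℕ} {a b : ι → Fin n}
    (ha : Function.Injective a) (hb : Function.Injective b) (hab : ∀ i j, a i ≠ b j) (l : List ι)
    (hl : l.Nodup) (x y : Fin n → Fin d) :
    (l.map fun j => partialTranspose {b j} (permOp d (Equiv.swap (a j) (b j)))).prod x y =
      open Classical in
      if (∀ j ∈ l, x (a j) = x (b j)) ∧ (∀ j ∈ l, y (a j) = y (b j)) ∧
        ∀ i, (∀ j ∈ l, i ≠ a j ∧ i ≠ b j) → x i = y i then 1 else 0 := by
  classical
  induction l generalizing x with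
  | nil =>
    simp only [List.map_nil, List.prod_nil, Matrix.one_apply]
    congr 1
    simp [funext_iff]
  | cons q l ih =>
    rw [List.nodup_cons] at hl
    rw [List.map_cons, List.prod_cons, Matrix.mul_apply]
    simp only [ih hl.2, partialTranspose_swap_apply (hab q q)]
    -- The intermediate basis vector is forced: the first factor makes it agree with `x` off the
    -- pair `q`, the remaining factors make it agree with `y` on that pair.
    rw [Finset.sum_eq_single fun i => if i = a q ∨ i = b q then y i else x i]
    · rw [indicator_mul_indicator]
      congr 1
      apply propext
      have hq : ∀ j ∈ l, a j ≠ a q ∧ b j ≠ b q := fun j hj =>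
        ⟨fun h => hl.1 (ha h ▸ hj), fun h => hl.1 (hb h ▸ hj)⟩
      have hab' : ∀ i j, b i ≠ a j := fun i j => (hab j i).symm
      constructor
      · rintro ⟨⟨h1, h2, h3⟩, h4, h5, h6⟩
        refine ⟨?_, ?_, ?_⟩
        · intro j hj
          rcases List.mem_cons.1 hj with rfl | hj
          · exact h1
          · simpa [hq j hj, hab, hab'] using h4 j hj
        · intro j hj
          rcases List.mem_cons.1 hj with rfl | hj
          · simpa using h2
          · exact h5 j hj
        · intro i hi
          have h7 := hi q List.mem_cons_self
          simpa [h7] using h6 i fun j hj => hi j (List.mem_cons_of_mem _ hj)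
      · rintro ⟨h1, h2, h3⟩
        refine ⟨⟨h1 q List.mem_cons_self, ?_, ?_⟩, ?_, ?_, ?_⟩
        · simpa using h2 q List.mem_cons_self
        · intro i h4 h5
          simp [h4, h5]
        · intro j hj
          simpa [hq j hj, hab, hab'] using h1 j (List.mem_cons_of_mem _ hj)
        · exact fun j hj => h2 j (List.mem_cons_of_mem _ hj)
        · intro i hi
          by_cases h4 : i = a q ∨ i = b q
          · simp [h4]
          · simp only [if_neg h4]
            rw [not_or] at h4
            refine h3 i fun j hj => ?_
            rcases List.mem_cons.1 hj with rfl | hj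
            · exact h4
            · exact hi j hj
    · intro z _ hz
      rw [indicator_mul_indicator, if_neg]
      rintro ⟨⟨h1, h2, h3⟩, h4, h5, h6⟩
      apply hz
      ext1 i
      split_ifs with h
      · refine h6 i fun j hj => ?_
        have h7 : a j ≠ a q ∧ b j ≠ b q :=
          ⟨fun h => hl.1 (ha h ▸ hj), fun h => hl.1 (hb h ▸ hj)⟩
        rcases h with rfl | rfl
        · exact ⟨h7.1.symm, hab _ _⟩
        · exact ⟨(hab _ _).symm, h7.2.symm⟩
      · rw [not_or] at h
        exact (h3 i h.1 h.2).symm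
    · simp

theorem contractionOp_eq (d m k : ℕ) :
    contractionOp d m k = arcs d m k * (arcs d m k).conjTranspose := by
  classical
  ext x y
  rw [contractionOp, List.ofFn_eq_map, prod_partialTranspose_swap_apply
    (a := fun j : Fin k => Fin.castAdd k (Fin.natAdd m j)) (b := fun j => Fin.natAdd (m + k) j.rev)
    _ _ _ _ (List.nodup_finRange k)]
  · obtain ⟨x, c, rfl⟩ := exists_eq_append x
    obtain ⟨x, a, rfl⟩ := exists_eq_append x
    obtain ⟨y, e, rfl⟩ := exists_eq_append y
    obtain ⟨y, b, rfl⟩ := exists_eq_append y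
    simp only [List.mem_finRange, true_implies, Fin.append_left, Fin.append_right]
    simp only [Matrix.mul_apply, Matrix.conjTranspose_apply, arcs_append, append_eq_append_iff]
    have h1 : (∀ i : Fin (m + k + k), (∀ j : Fin k, i ≠ Fin.castAdd k (Fin.natAdd m j) ∧
        i ≠ Fin.natAdd (m + k) j.rev) →
        Fin.append (Fin.append x a) c i = Fin.append (Fin.append y b) e i) ↔ x = y := by
      constructor
      · intro h
        ext1 i
        have h2 := h (Fin.castAdd k (Fin.castAdd k i)) fun j => by
          constructor
          · intro h
            have := congrArg Fin.val h
            simp only [Fin.val_natAdd, Fin.val_castAdd] at this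
            omega
          · intro h
            have := congrArg Fin.val h
            simp only [Fin.val_natAdd, Fin.val_castAdd] at this
            omega
        simpa using h2
      · rintro rfl i hi
        revert hi
        refine Fin.addCases (fun i => ?_) (fun j => ?_) i
        · refine Fin.addCases (fun i => ?_) (fun j => ?_) i
          · simp
          · exact fun hi => absurd rfl (hi j).1
        · intro hi
          exact absurd (by simp) (hi j.rev).2
    have h2 : ∀ a c : Fin k → Fin d, (∀ j, a j = c j.rev) ↔ a = c ∘ Fin.rev := fun a c =>
      funext_iff.symm
    simp only [h1, h2]
    by_cases h3 : a = c ∘ Fin.rev <;> by_cases h4 : b = e ∘ Fin.rev <;> simp [h3, h4]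
  · intro i j h
    simpa using h
  · intro i j h
    simpa using h
  · intro i j h
    have := congrArg Fin.val h
    simp only [Fin.val_natAdd, Fin.val_castAdd] at this
    omega

variable {d m k : ℕ}

theorem contractionOp_conjTranspose : (contractionOp d m k).conjTranspose = contractionOp d m k := by
  rw [contractionOp_eq, Matrix.conjTranspose_mul, Matrix.conjTranspose_conjTranspose]

/-- In arcs · (arcs† (X ⊗ 1) arcs) · arcs† the middle is the partial trace, which then moves to the
left through the arcs. -/
theorem contractionOp_mul_tensorOne_mul (X : Op d (m + k)) :
    contractionOp d m k * tensorOne k X * contractionOp d m k =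
      tensorOne k (tensorOne k (partialTrace d m k X)) * contractionOp d m k := by
  rw [contractionOp_eq, ← Matrix.mul_assoc (tensorOne k (tensorOne k _)),
    tensorOne_tensorOne_mul_arcs, ← conjTranspose_arcs_mul_tensorOne_mul_arcs]
  simp only [Matrix.mul_assoc]

theorem tensorOne_mul_contractionOp_comm (A : Op d m) :
    tensorOne k (tensorOne k A) * contractionOp d m k =
      contractionOp d m k * tensorOne k (tensorOne k A) := by
  rw [contractionOp_eq, ← Matrix.mul_assoc, tensorOne_tensorOne_mul_arcs]
  have h := congrArg Matrix.conjTranspose (tensorOne_tensorOne_mul_arcs (k := k) A.conjTranspose)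
  rw [Matrix.conjTranspose_mul, Matrix.conjTranspose_mul, tensorOne_conjTranspose,
    tensorOne_conjTranspose, Matrix.conjTranspose_conjTranspose] at h
  rw [Matrix.mul_assoc, Matrix.mul_assoc, h]

theorem trace_tensorOne_mul_contractionOp (X : Op d (m + k)) :
    Matrix.trace (tensorOne k X * contractionOp d m k) = Matrix.trace X := by
  rw [contractionOp_eq, ← Matrix.mul_assoc, Matrix.trace_mul_comm,
    conjTranspose_arcs_mul_tensorOne_mul_arcs, trace_partialTrace]

end ContractionOp

/-! ### The commutant -/

section Commutant

/-- The tensor product of one-particle operators. -/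
def productOp {d n : ℕ} (A : Fin n → Matrix (Fin d) (Fin d) ℂ) : Op d n :=
  Matrix.of fun x y => ∏ i, A i (x i) (y i)

variable {d n : ℕ}

theorem productOp_mul (A B : Fin n → Matrix (Fin d) (Fin d) ℂ) :
    productOp A * productOp B = productOp fun i => A i * B i := by
  ext x y
  simp only [productOp, Matrix.mul_apply, Matrix.of_apply, ← Finset.prod_mul_distrib]
  rw [Finset.prod_univ_sum, Fintype.piFinset_univ]

theorem productOp_one : productOp (fun _ : Fin n => (1 : Matrix (Fin d) (Fin d) ℂ)) = 1 := by
  ext x y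
  rw [productOp, Matrix.of_apply, Matrix.one_apply]
  split_ifs with h
  · subst h
    simp
  · obtain ⟨i, hi⟩ := Function.ne_iff.1 h
    exact Finset.prod_eq_zero (Finset.mem_univ i) (by simp [hi])

theorem productOp_mul_permOp (U : Matrix (Fin d) (Fin d) ℂ) (σ : Equiv.Perm (Fin n)) :
    productOp (fun _ => U) * permOp d σ = permOp d σ * productOp fun _ => U := by
  ext x y
  rw [mul_permOp_apply, Matrix.mul_apply, Finset.sum_eq_single (x ∘ σ)]
  · rw [permOp_apply, if_pos (by ext i; simp), one_mul]
    simp only [productOp, Matrix.of_apply, Function.comp_apply]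
    refine Fintype.prod_equiv σ.symm _ _ fun i => ?_
    rw [Equiv.apply_symm_apply]
    rfl
  · intro z _ hz
    rw [permOp_apply, if_neg, zero_mul]
    rintro rfl
    apply hz
    ext i
    simp
  · simp

/-- Exchanging the subsystems in `s` of a pair of basis vectors. -/
def exchange (s : Finset (Fin n)) :
    Equiv.Perm ((Fin n → Fin d) × (Fin n → Fin d)) :=
  Function.Involutive.toPerm
    (fun p => (fun i => if i ∈ s then p.2 i else p.1 i, fun i => if i ∈ s then p.1 i else p.2 i))
    (by
      rintro ⟨x, y⟩
      ext i <;> by_cases h : i ∈ s <;> simp [h])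

theorem exchange_apply (s : Finset (Fin n)) (z w : Fin n → Fin d) :
    exchange s (z, w) =
      (fun i => if i ∈ s then w i else z i, fun i => if i ∈ s then z i else w i) := rfl

/-- Exchanging the `s`-coordinates of the two summed basis vectors moves the one-particle factors on
`s` to the opposite side, transposed. -/
theorem partialTranspose_productOp_mul_mul (s : Finset (Fin n))
    (A B : Fin n → Matrix (Fin d) (Fin d) ℂ) (X : Op d n) :
    partialTranspose s (productOp A * X * productOp B) =
      productOp (fun i => if i ∈ s then (B i).transpose else A i) * partialTranspose s X *
        productOp (fun i => if i ∈ s then (A i).transpose else B i) := by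
  have h : ∀ (A B : Fin n → Matrix (Fin d) (Fin d) ℂ) (X : Op d n) (x y : Fin n → Fin d),
      (productOp A * X * productOp B) x y = ∑ p : (Fin n → Fin d) × (Fin n → Fin d),
        (∏ i, A i (x i) (p.1 i) * B i (p.2 i) (y i)) * X p.1 p.2 := by
    intro A B X x y
    rw [Matrix.mul_apply, Fintype.sum_prod_type_right]
    refine Finset.sum_congr rfl fun w _ => ?_
    rw [Matrix.mul_apply, Finset.sum_mul]
    refine Finset.sum_congr rfl fun z _ => ?_
    simp only [productOp, Matrix.of_apply, Finset.prod_mul_distrib]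
    ring
  ext x y
  rw [h, partialTranspose, Matrix.of_apply, h]
  refine Fintype.sum_equiv (exchange s) _ _ fun p => ?_
  obtain ⟨z, w⟩ := p
  rw [partialTranspose, Matrix.of_apply]
  congr 1
  · refine Finset.prod_congr rfl fun i _ => ?_
    by_cases hi : i ∈ s
    · simp [exchange_apply, hi, mul_comm]
    · simp [exchange_apply, hi]
  · congr 1
    · ext1 i
      by_cases hi : i ∈ s <;> simp [exchange_apply, hi]
    · ext1 i
      by_cases hi : i ∈ s <;> simp [exchange_apply, hi]

theorem mixedTensorPower_eq (N k : ℕ) (U : Matrix (Fin d) (Fin d) ℂ) :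
    mixedTensorPower N k U =
      productOp fun i => if i ∈ lastSystems N k then U.conjTranspose.transpose else U := by
  ext x y
  simp [mixedTensorPower, productOp, Fin.prod_univ_add, mem_lastSystems_natAdd,
    notMem_lastSystems_castAdd]

/-- Partially transposing U^{⊗n} V_σ (U†)^{⊗n} = V_σ turns the outer factors into the mixed tensor
power and its inverse. -/
theorem ptAlgebra_le_mixedCommutant (d N k : ℕ) : ptAlgebra d N k ≤ mixedCommutant d N k := by
  refine Algebra.adjoin_le ?_
  rintro _ ⟨σ, rfl⟩
  rw [mixedCommutant, SetLike.mem_coe, Subalgebra.mem_centralizer_iff]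
  rintro _ ⟨U, hU, rfl⟩
  have hU1 : U * U.conjTranspose = 1 := (Matrix.mem_unitaryGroup_iff).1 hU
  have hU2 : U.conjTranspose * U = 1 := (Matrix.mem_unitaryGroup_iff').1 hU
  have h1 : productOp (fun _ : Fin (N + k) => U) * permOp d σ *
      productOp (fun _ => U.conjTranspose) = permOp d σ := by
    rw [productOp_mul_permOp, mul_assoc, productOp_mul]
    simp [hU1, productOp_one]
  have h2 := partialTranspose_productOp_mul_mul (lastSystems N k) (fun _ => U)
    (fun _ => U.conjTranspose) (permOp d σ)
  have h3 : productOp (fun i => if i ∈ lastSystems N k then U.transpose else U.conjTranspose) *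
      productOp (fun i => if i ∈ lastSystems N k then U.conjTranspose.transpose else U) = 1 := by
    rw [productOp_mul, ← productOp_one]
    congr 1
    ext1 i
    split_ifs
    · rw [← Matrix.transpose_mul, hU2, Matrix.transpose_one]
    · exact hU2
  rw [mixedTensorPower_eq]
  rw [h1] at h2
  beta_reduce
  conv_rhs => rw [h2]
  rw [mul_assoc, h3, mul_one]

end Commutant

/-! ### The ideal -/

section Ideal

variable {d m k : ℕ}

theorem contractionOp_mem_ptAlgebra : contractionOp d m k ∈ ptAlgebra d (m + k) k := by
  rw [contractionOp_eq, ← partialTranspose_arcPerm]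
  exact Algebra.subset_adjoin ⟨_, rfl⟩

theorem idealM_le_mixedCommutant :
    idealM d m k ≤ Subalgebra.toSubmodule (mixedCommutant d (m + k) k) := by
  rw [idealM, Submodule.span_le]
  rintro _ ⟨A, hA, B, hB, rfl⟩
  exact ptAlgebra_le_mixedCommutant _ _ _
    (mul_mem (mul_mem hA contractionOp_mem_ptAlgebra) hB)

theorem partialTranspose_mul_tensorOne {N : ℕ} (A : Op d (N + k)) (X : Op d N) :
    partialTranspose (lastSystems N k) A * tensorOne k X =
      partialTranspose (lastSystems N k) (A * tensorOne k X) := by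
  ext x y
  obtain ⟨x, c, rfl⟩ := exists_eq_append x
  obtain ⟨y, e, rfl⟩ := exists_eq_append y
  rw [partialTranspose_lastSystems_append, Matrix.mul_apply, Matrix.mul_apply, sum_append,
    sum_append]
  refine Finset.sum_congr rfl fun z _ => ?_
  simp only [partialTranspose_lastSystems_append, tensorOne_append]
  simp

theorem partialTranspose_tensorOne {N : ℕ} (X : Op d N) :
    partialTranspose (lastSystems N k) (tensorOne k X) = tensorOne k X := by
  ext x y
  obtain ⟨x, c, rfl⟩ := exists_eq_append x
  obtain ⟨y, e, rfl⟩ := exists_eq_append y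
  rw [partialTranspose_lastSystems_append, tensorOne_append, tensorOne_append]
  simp only [eq_comm]

theorem tensorOne_permOp_mem_ptAlgebra {N : ℕ} (σ : Equiv.Perm (Fin N)) :
    tensorOne k (permOp d σ) ∈ ptAlgebra d N k := by
  rw [← partialTranspose_tensorOne, tensorOne_permOp]
  exact Algebra.subset_adjoin ⟨_, rfl⟩

theorem tensorOne_mem_ptAlgebra {N : ℕ} {X : Op d N}
    (hX : X ∈ Submodule.span ℂ (Set.range (permOp d (n := N)))) :
    tensorOne k X ∈ ptAlgebra d N k := by
  have h : Submodule.span ℂ (Set.range (permOp d (n := N))) ≤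
      (Subalgebra.toSubmodule (ptAlgebra d N k)).comap (tensorOneₗ d N k) := by
    rw [Submodule.span_le]
    rintro _ ⟨σ, rfl⟩
    exact tensorOne_permOp_mem_ptAlgebra σ
  exact h hX

theorem conjTranspose_mem_ptAlgebra {N : ℕ} {A : Op d (N + k)} (hA : A ∈ ptAlgebra d N k) :
    A.conjTranspose ∈ ptAlgebra d N k := by
  induction hA using Algebra.adjoin_induction with
  | mem x hx =>
    obtain ⟨σ, rfl⟩ := hx
    refine Algebra.subset_adjoin ⟨σ⁻¹, ?_⟩
    beta_reduce
    rw [← permOp_conjTranspose]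
    rfl
  | algebraMap r =>
    have h : ((algebraMap ℂ (Op d (N + k))) r).conjTranspose = algebraMap ℂ _ (star r) := by
      simp [Algebra.algebraMap_eq_smul_one]
    rw [h]
    exact Subalgebra.algebraMap_mem _ _
  | add x y _ _ hx hy =>
    rw [Matrix.conjTranspose_add]
    exact add_mem hx hy
  | mul x y _ _ hx hy =>
    rw [Matrix.conjTranspose_mul]
    exact mul_mem hy hx

theorem conjTranspose_mem_span_permOp {n : ℕ} {X : Op d n}
    (hX : X ∈ Submodule.span ℂ (Set.range (permOp d (n := n)))) :
    X.conjTranspose ∈ Submodule.span ℂ (Set.range (permOp d (n := n))) := by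
  induction hX using Submodule.span_induction with
  | zero => simp
  | add x y _ _ hx hy => rw [Matrix.conjTranspose_add]; exact add_mem hx hy
  | smul c x _ hx => rw [Matrix.conjTranspose_smul]; exact Submodule.smul_mem _ _ hx
  | mem x hx =>
    obtain ⟨σ, rfl⟩ := hx
    rw [permOp_conjTranspose]
    exact Submodule.subset_span ⟨_, rfl⟩

/-- On the arcs, the walled Brauer algebra acts through the permutations of the first `m + k`
subsystems. -/
theorem exists_mul_arcs_eq {A : Op d (m + k + k)} (hA : A ∈ ptAlgebra d (m + k) k) :
    ∃ T ∈ Submodule.span ℂ (Set.range (permOp d (n := m + k))),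
      A * arcs d m k = tensorOne k T * arcs d m k := by
  -- It suffices that this space, which contains the arcs, is stable under the algebra. A generator
  -- times T ⊗ 1 is again a partial transpose, of an operator in the span of permutations;
  -- `partialTranspose_mul_arcs` brings it back to the required form.
  let S : Submodule ℂ (Matrix (Fin (m + k + k) → Fin d) (Fin m → Fin d) ℂ) :=
    (Submodule.span ℂ (Set.range (permOp d (n := m + k)))).map
      (mulRightLinearMap _ ℂ (arcs d m k) ∘ₗ tensorOneₗ d (m + k) k)
  have hS : ∀ T ∈ Submodule.span ℂ (Set.range (permOp d (n := m + k))),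
      tensorOne k T * arcs d m k ∈ S := fun T hT => ⟨T, hT, rfl⟩
  have h1 : ∀ M ∈ S, A * M ∈ S := by
    induction hA using Algebra.adjoin_induction with
    | mem x hx =>
      obtain ⟨σ, rfl⟩ := hx
      rintro _ ⟨T, hT, rfl⟩
      change _ * (tensorOne k T * arcs d m k) ∈ S
      rw [← Matrix.mul_assoc, partialTranspose_mul_tensorOne, partialTranspose_mul_arcs]
      refine hS _ (partialTrace_mem _ ?_)
      induction hT using Submodule.span_induction with
      | zero => simp [tensorOne_zero]
      | add x y _ _ hx hy =>
        rw [← tensorOneₗ_apply, map_add, mul_add, add_mul]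
        exact add_mem hx hy
      | smul c x _ hx =>
        rw [tensorOne_smul, mul_smul_comm, smul_mul_assoc]
        exact Submodule.smul_mem _ _ hx
      | mem x hx =>
        obtain ⟨τ, rfl⟩ := hx
        rw [tensorOne_permOp, ← permOp_mul, ← permOp_mul]
        exact Submodule.subset_span ⟨_, rfl⟩
    | algebraMap r =>
      intro M hM
      rw [Algebra.algebraMap_eq_smul_one, Matrix.smul_mul, Matrix.one_mul]
      exact S.smul_mem _ hM
    | add x y _ _ hx hy =>
      intro M hM
      rw [Matrix.add_mul]
      exact S.add_mem (hx M hM) (hy M hM)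
    | mul x y _ _ hx hy =>
      intro M hM
      rw [Matrix.mul_assoc]
      exact hx _ (hy M hM)
  have h2 : arcs d m k ∈ S := by
    have := hS 1 (Submodule.subset_span ⟨1, permOp_one⟩)
    rwa [tensorOne_one, Matrix.one_mul] at this
  obtain ⟨T, hT, h⟩ := h1 _ h2
  exact ⟨T, hT, h.symm⟩

theorem mem_idealM_of_mem_span {T T' : Op d (m + k)}
    (hT : T ∈ Submodule.span ℂ (Set.range (permOp d (n := m + k))))
    (hT' : T' ∈ Submodule.span ℂ (Set.range (permOp d (n := m + k)))) :
    tensorOne k T * contractionOp d m k * tensorOne k T' ∈ idealM d m k :=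
  Submodule.subset_span ⟨_, tensorOne_mem_ptAlgebra hT, _, tensorOne_mem_ptAlgebra hT', rfl⟩

/-- The left factor is reduced by its action on the arcs, the right factor by applying the same
statement to its adjoint. -/
theorem idealM_le {S : Submodule ℂ (Op d (m + k + k))}
    (h : ∀ T ∈ Submodule.span ℂ (Set.range (permOp d (n := m + k))),
      ∀ T' ∈ Submodule.span ℂ (Set.range (permOp d (n := m + k))),
        tensorOne k T * contractionOp d m k * tensorOne k T' ∈ S) : idealM d m k ≤ S := by
  rw [idealM, Submodule.span_le]
  rintro _ ⟨A, hA, B, hB, rfl⟩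
  obtain ⟨T, hT, h1⟩ := exists_mul_arcs_eq hA
  obtain ⟨T', hT', h2⟩ := exists_mul_arcs_eq (conjTranspose_mem_ptAlgebra hB)
  have h3 := congrArg Matrix.conjTranspose h2
  rw [Matrix.conjTranspose_mul, Matrix.conjTranspose_mul, Matrix.conjTranspose_conjTranspose,
    tensorOne_conjTranspose] at h3
  have h4 := h T hT _ (conjTranspose_mem_span_permOp hT')
  rw [contractionOp_eq] at h4 ⊢
  rw [← Matrix.mul_assoc, Matrix.mul_assoc, ← h1, ← h3] at h4
  rw [SetLike.mem_coe, ← Matrix.mul_assoc, Matrix.mul_assoc]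
  exact h4

end Ideal

/-! ### The operators `F` -/

section Basis

variable {d m k : ℕ}
  {φ : (n : ℕ) → (μ : Shape n) → Equiv.Perm (Fin n) →* Matrix.unitaryGroup (Idx n μ) ℂ}
  {one : (m : ℕ) → (α : Shape m) → Idx m α}

theorem Label.colLen_le {α : Shape m} (a : Label d k α) : α.1.colLen 0 ≤ d :=
  (colLen_mono a.2.1.le 0).trans a.1.2

theorem IsPRIR.mult_label_ne_zero (hφ : IsPRIR φ) {α : Shape m} (a : Label d k α) :
    mult φ d a.1.1 ≠ 0 :=
  hφ.mult_ne_zero a.1.2 a.2.2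

theorem opF_conjTranspose (α : Shape m) (a b : Label d k α) :
    (opF φ one d α a b).conjTranspose = opF φ one d α b a := by
  rw [opF, opF, Matrix.conjTranspose_smul, Matrix.conjTranspose_mul, Matrix.conjTranspose_mul,
    tensorOne_conjTranspose, tensorOne_conjTranspose, opE_conjTranspose, opE_conjTranspose,
    contractionOp_conjTranspose, mul_comm (mult φ d a.1.1 : ℝ), ← Matrix.mul_assoc]
  congr 1
  exact Complex.conj_ofReal _

theorem opF_mul_opF (α β : Shape m) (a b : Label d k α) (c e : Label d k β) :
    opF φ one d α a b * opF φ one d β c e =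
      (((mult φ d α / √(mult φ d a.1.1 * mult φ d b.1.1) : ℝ) : ℂ) *
        ((mult φ d β / √(mult φ d c.1.1 * mult φ d e.1.1) : ℝ) : ℂ)) •
      (tensorOne k (opE φ d a.1.1 a.2.2 (a.2.1.append (one m α)) *
          tensorOne k (partialTrace d m k (opE φ d b.1.1 (b.2.1.append (one m α)) b.2.2 *
            opE φ d c.1.1 c.2.2 (c.2.1.append (one m β))))) * contractionOp d m k *
        tensorOne k (opE φ d e.1.1 (e.2.1.append (one m β)) e.2.2)) := by
  rw [opF, opF, smul_mul_assoc, mul_smul_comm, smul_smul, tensorOne_mul,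
    Matrix.mul_assoc (tensorOne k _) (tensorOne k (tensorOne k _)),
    ← contractionOp_mul_tensorOne_mul, tensorOne_mul]
  simp only [Matrix.mul_assoc]

theorem IsPRIR.opF_mul_opF_of_shape_ne (hφ : IsPRIR φ) {α β : Shape m} (hne : α ≠ β)
    (a b : Label d k α) (c e : Label d k β) :
    opF φ one d α a b * opF φ one d β c e = 0 := by
  have h : partialTrace d m k (opE φ d b.1.1 (b.2.1.append (one m α)) b.2.2 *
      opE φ d c.1.1 c.2.2 (c.2.1.append (one m β))) = 0 := by
    obtain ⟨⟨μ, hμ⟩, r, i⟩ := b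
    obtain ⟨⟨ν, hν⟩, s, j⟩ := c
    rcases eq_or_ne μ ν with rfl | hμν
    · rw [hφ.opE_mul_opE]
      split_ifs
      · exact hφ.partialTrace_opE_of_ne hne r s _ _
      · exact map_zero _
    · rw [hφ.opE_mul_of_ne hμν, map_zero]
  rw [opF_mul_opF, h]
  simp [tensorOne_zero]

theorem IsPRIR.opF_mul_opF_of_ne (hφ : IsPRIR φ) {α : Shape m} (a b c e : Label d k α)
    (hne : b ≠ c) : opF φ one d α a b * opF φ one d α c e = 0 := by
  have h : partialTrace d m k (opE φ d b.1.1 (b.2.1.append (one m α)) b.2.2 *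
      opE φ d c.1.1 c.2.2 (c.2.1.append (one m α))) = 0 := by
    have hα := b.colLen_le
    obtain ⟨⟨μ, hμ⟩, r, i⟩ := b
    obtain ⟨⟨ν, hν⟩, s, j⟩ := c
    rcases eq_or_ne μ ν with rfl | hμν
    · rw [hφ.opE_mul_opE]
      split_ifs with hij
      · rw [hφ.partialTrace_opE hα, if_neg]
        rintro rfl
        apply hne
        change i = j at hij
        rw [hij]
      · exact map_zero _
    · rw [hφ.opE_mul_of_ne hμν, map_zero]
  rw [opF_mul_opF, h]
  simp [tensorOne_zero]

theorem IsPRIR.opF_mul_opF_self (hφ : IsPRIR φ) {α : Shape m} (a b e : Label d k α) :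
    opF φ one d α a b * opF φ one d α b e = opF φ one d α a e := by
  have h : partialTrace d m k (opE φ d b.1.1 (b.2.1.append (one m α)) b.2.2 *
      opE φ d b.1.1 b.2.2 (b.2.1.append (one m α))) =
      ((mult φ d b.1.1 : ℂ) / mult φ d α) • opE φ d α (one m α) (one m α) := by
    rw [hφ.opE_mul_opE, if_pos rfl, hφ.partialTrace_opE b.colLen_le, if_pos rfl]
  have hα : (mult φ d α : ℝ) ≠ 0 := by exact_mod_cast hφ.mult_ne_zero b.colLen_le (one m α)
  have hb : (√(mult φ d b.1.1) : ℝ) ≠ 0 := by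
    rw [Real.sqrt_ne_zero']
    exact_mod_cast Nat.pos_of_ne_zero (hφ.mult_label_ne_zero b)
  have ha : (√(mult φ d a.1.1) : ℝ) ≠ 0 := by
    rw [Real.sqrt_ne_zero']
    exact_mod_cast Nat.pos_of_ne_zero (hφ.mult_label_ne_zero a)
  have he : (√(mult φ d e.1.1) : ℝ) ≠ 0 := by
    rw [Real.sqrt_ne_zero']
    exact_mod_cast Nat.pos_of_ne_zero (hφ.mult_label_ne_zero e)
  -- The factor m_ν/m_α produced by the partial trace, with ν the shape of the common label `b`, is
  -- exactly what the two normalizations leave over.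
  have hcoef : (mult φ d α / √(mult φ d a.1.1 * mult φ d b.1.1) : ℝ) *
      (mult φ d α / √(mult φ d b.1.1 * mult φ d e.1.1) : ℝ) *
        ((mult φ d b.1.1 : ℝ) / mult φ d α) =
      mult φ d α / √(mult φ d a.1.1 * mult φ d e.1.1) := by
    rw [Real.sqrt_mul (Nat.cast_nonneg _), Real.sqrt_mul (Nat.cast_nonneg _),
      Real.sqrt_mul (Nat.cast_nonneg _)]
    have hbb : (mult φ d b.1.1 : ℝ) = √(mult φ d b.1.1) * √(mult φ d b.1.1) :=
      (Real.mul_self_sqrt (Nat.cast_nonneg _)).symm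
    generalize (√(mult φ d b.1.1) : ℝ) = x at *
    rw [hbb]
    field_simp
  rw [opF_mul_opF, h, tensorOne_smul, mul_smul_comm, hφ.opE_mul_tensorOne_opE, if_pos rfl,
    tensorOne_smul, smul_mul_assoc, smul_mul_assoc, smul_smul, opF, ← hcoef]
  push_cast
  rfl

theorem IsPRIR.trace_opF_self (hφ : IsPRIR φ) {α : Shape m} (a : Label d k α) :
    Matrix.trace (opF φ one d α a a) = mult φ d α := by
  have ha : (mult φ d a.1.1 : ℂ) ≠ 0 := by exact_mod_cast hφ.mult_label_ne_zero a
  rw [opF, Matrix.trace_smul, Matrix.trace_mul_comm, ← Matrix.mul_assoc, ← tensorOne_mul,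
    hφ.opE_mul_opE, if_pos rfl, trace_tensorOne_mul_contractionOp, hφ.trace_opE, if_pos rfl,
    Real.sqrt_mul_self (Nat.cast_nonneg _)]
  push_cast
  rw [smul_eq_mul, div_mul_cancel₀ _ ha]

theorem IsPRIR.trace_opF_of_ne (hφ : IsPRIR φ) {α : Shape m} (a b : Label d k α) (hne : a ≠ b) :
    Matrix.trace (opF φ one d α a b) = 0 := by
  have h : opF φ one d α a b = opF φ one d α a a * opF φ one d α a b :=
    (hφ.opF_mul_opF_self a a b).symm
  rw [h, Matrix.trace_mul_comm, hφ.opF_mul_opF_of_ne _ _ _ _ hne.symm, Matrix.trace_zero]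

/-! ### Spanning and linear independence. -/

theorem IsPRIR.opF_mem_idealM (hφ : IsPRIR φ) (α : Shape m) (a b : Label d k α) :
    opF φ one d α a b ∈ idealM d m k :=
  Submodule.smul_mem _ _ (mem_idealM_of_mem_span (hφ.opE_mem_span _ _ _) (hφ.opE_mem_span _ _ _))

/-- The tail index `l` is split off as a factor E^α_{1,l} ⊗ 1, which commutes with V^{(k)} and acts
on the right-hand unit: it replaces the tail `l'` by the fixed index when the tails agree, and
annihilates the unit otherwise. Units with more than `d` rows are zero. -/
theorem IsPRIR.tensorOne_opE_mul_contractionOp_mul_mem (hφ : IsPRIR φ)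
    (one : (m : ℕ) → (α : Shape m) → Idx m α) (μ ν : Shape (m + k))
    (i j : Idx (m + k) μ) (p q : Idx (m + k) ν) :
    tensorOne k (opE φ d μ i j) * contractionOp d m k * tensorOne k (opE φ d ν p q) ∈
      Submodule.span ℂ (Set.range fun x : Σ α : Shape m, Label d k α × Label d k α =>
        opF φ one d x.1 x.2.1 x.2.2) := by
  by_cases hμ : μ.1.colLen 0 ≤ d
  swap
  · rw [hφ.opE_eq_zero (not_le.1 hμ), tensorOne_zero, Matrix.zero_mul, Matrix.zero_mul]
    exact zero_mem _
  by_cases hν : ν.1.colLen 0 ≤ d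
  swap
  · rw [hφ.opE_eq_zero (not_le.1 hν), tensorOne_zero, Matrix.mul_zero]
    exact zero_mem _
  obtain ⟨α, r, l, rfl⟩ := exists_append_eq (m := m) j
  obtain ⟨β, s, l', rfl⟩ := exists_append_eq (m := m) p
  have h1 : opE φ d μ i (r.append l) =
      opE φ d μ i (r.append (one m α)) * tensorOne k (opE φ d α (one m α) l) := by
    rw [hφ.opE_mul_tensorOne_opE, if_pos rfl]
  rw [h1, tensorOne_mul, Matrix.mul_assoc (tensorOne k _), tensorOne_mul_contractionOp_comm,
    Matrix.mul_assoc, Matrix.mul_assoc (contractionOp d m k), ← tensorOne_mul, ← Matrix.mul_assoc]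
  rcases eq_or_ne α β with rfl | hne
  · rw [hφ.tensorOne_opE_mul_opE]
    split_ifs
    · have hα : (mult φ d α : ℝ) ≠ 0 := by
        exact_mod_cast hφ.mult_ne_zero ((colLen_mono r.le 0).trans hμ) l
      have hμν : (√(mult φ d μ * mult φ d ν) : ℝ) ≠ 0 := by
        rw [Real.sqrt_ne_zero']
        exact_mod_cast Nat.pos_of_ne_zero
          (mul_ne_zero (hφ.mult_ne_zero hμ i) (hφ.mult_ne_zero hν q))
      have hc : ((mult φ d α / √(mult φ d μ * mult φ d ν) : ℝ) : ℂ) ≠ 0 :=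
        Complex.ofReal_ne_zero.2 (div_ne_zero hα hμν)
      refine (Submodule.smul_mem_iff _ hc).1 (Submodule.subset_span ⟨⟨α, ⟨⟨μ, hμ⟩, r, i⟩,
        ⟨⟨ν, hν⟩, s, q⟩⟩, rfl⟩)
    · rw [tensorOne_zero, Matrix.mul_zero]
      exact zero_mem _
  · rw [hφ.tensorOne_opE_mul_opE_of_ne hne, tensorOne_zero, Matrix.mul_zero]
    exact zero_mem _

theorem IsPRIR.span_opF (hφ : IsPRIR φ) (one : (m : ℕ) → (α : Shape m) → Idx m α) :
    Submodule.span ℂ (Set.range fun x : Σ α : Shape m, Label d k α × Label d k α =>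
      opF φ one d x.1 x.2.1 x.2.2) = idealM d m k := by
  apply le_antisymm
  · rw [Submodule.span_le]
    rintro _ ⟨x, rfl⟩
    exact hφ.opF_mem_idealM _ _ _
  · refine idealM_le fun T hT T' hT' => ?_
    rw [← hφ.span_opE] at hT hT'
    induction hT using Submodule.span_induction with
    | zero => rw [tensorOne_zero, Matrix.zero_mul, Matrix.zero_mul]; exact zero_mem _
    | add x y _ _ hx hy =>
      rw [← tensorOneₗ_apply, map_add, Matrix.add_mul, Matrix.add_mul]
      exact add_mem hx hy
    | smul c x _ hx =>
      rw [tensorOne_smul, Matrix.smul_mul, Matrix.smul_mul]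
      exact Submodule.smul_mem _ _ hx
    | mem x hx =>
      obtain ⟨⟨μ, i, j⟩, rfl⟩ := hx
      induction hT' using Submodule.span_induction with
      | zero => rw [tensorOne_zero, Matrix.mul_zero]; exact zero_mem _
      | add x y _ _ hx hy =>
        rw [← tensorOneₗ_apply (x + y), map_add, Matrix.mul_add]
        exact add_mem hx hy
      | smul c x _ hx =>
        rw [tensorOne_smul, Matrix.mul_smul]
        exact Submodule.smul_mem _ _ hx
      | mem x hx =>
        obtain ⟨⟨ν, p, q⟩, rfl⟩ := hx
        exact hφ.tensorOne_opE_mul_contractionOp_mul_mem one μ ν i j p q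

/-- Pairing a vanishing combination with F_{ba} under the trace isolates the coefficient of F_{ab},
multiplied by m_α ≠ 0. -/
theorem IsPRIR.linearIndependent_opF (hφ : IsPRIR φ) :
    LinearIndependent ℂ (fun x : Σ α : Shape m, Label d k α × Label d k α =>
      opF φ one d x.1 x.2.1 x.2.2) := by
  rw [linearIndependent_iff']
  rintro s g hg ⟨α, a, b⟩ hx
  have hα : (mult φ d α : ℂ) ≠ 0 := by exact_mod_cast hφ.mult_ne_zero a.colLen_le (one m α)
  have h := congrArg (fun X => Matrix.trace (opF φ one d α b a * X)) hg
  simp only [Matrix.mul_sum, Matrix.mul_smul, Matrix.trace_sum, Matrix.trace_smul,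
    Matrix.mul_zero, Matrix.trace_zero] at h
  rw [Finset.sum_eq_single ⟨α, a, b⟩] at h
  · rw [hφ.opF_mul_opF_self, hφ.trace_opF_self, smul_eq_mul] at h
    exact (mul_eq_zero.1 h).resolve_right hα
  · rintro ⟨β, c, e⟩ _ hne
    rcases eq_or_ne α β with rfl | hαβ
    · rcases eq_or_ne a c with rfl | hac
      · rw [hφ.opF_mul_opF_self, hφ.trace_opF_of_ne, smul_zero]
        rintro rfl
        exact hne rfl
      · rw [hφ.opF_mul_opF_of_ne _ _ _ _ hac, Matrix.trace_zero, smul_zero]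
    · rw [hφ.opF_mul_opF_of_shape_ne hαβ, Matrix.trace_zero, smul_zero]
  · exact fun h => absurd hx h

end Basis

end WalledBrauer

end

open WalledBrauer
open Classical in
theorem mainTheorem5 (d m k : ℕ)
    (φ : (n : ℕ) → (μ : Shape n) → Equiv.Perm (Fin n) →* Matrix.unitaryGroup (Idx n μ) ℂ)
    (hφ : IsPRIR φ) (one : (m : ℕ) → (α : Shape m) → Idx m α) :
    -- the operators `F` form a basis of `M`
    LinearIndependent ℂ
      (fun x : Σ α : Shape m, Label d k α × Label d k α => opF φ one d x.1 x.2.1 x.2.2) ∧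
    Submodule.span ℂ
      (Set.range fun x : Σ α : Shape m, Label d k α × Label d k α =>
        opF φ one d x.1 x.2.1 x.2.2) = idealM d m k ∧
    -- `M` lies in the commutant
    idealM d m k ≤ Subalgebra.toSubmodule (mixedCommutant d (m + k) k) ∧
    -- the composition rule
    (∀ (α : Shape m) (a b c e : Label d k α),
      opF φ one d α a b * opF φ one d α c e = if b = c then opF φ one d α a e else 0) ∧
    (∀ (α β : Shape m) (a b : Label d k α) (c e : Label d k β), α ≠ β →
      opF φ one d α a b * opF φ one d β c e = 0) ∧
    -- orthonormality for the trace inner product, normalized by `m_α`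
    (∀ (α : Shape m) (a b c e : Label d k α),
      Matrix.trace ((opF φ one d α a b).conjTranspose * opF φ one d α c e) =
        if a = c ∧ b = e then (mult φ d α : ℂ) else 0) ∧
    (∀ (α β : Shape m) (a b : Label d k α) (c e : Label d k β), α ≠ β →
      Matrix.trace ((opF φ one d α a b).conjTranspose * opF φ one d β c e) = 0) := by
  refine ⟨hφ.linearIndependent_opF, hφ.span_opF one, idealM_le_mixedCommutant, ?_, ?_, ?_, ?_⟩
  · intro α a b c e
    split_ifs with h
    · rw [h, hφ.opF_mul_opF_self]
    · exact hφ.opF_mul_opF_of_ne a b c e h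
  · exact fun α β a b c e h => hφ.opF_mul_opF_of_shape_ne h a b c e
  · intro α a b c e
    -- The adjoint exchanges the two labels, so the inner product reduces to the composition rule
    -- and the trace of a single `opF`.
    rw [opF_conjTranspose]
    split_ifs with h
    · rw [h.1, h.2, hφ.opF_mul_opF_self, hφ.trace_opF_self]
    · rcases eq_or_ne a c with rfl | hac
      · rw [hφ.opF_mul_opF_self, hφ.trace_opF_of_ne _ _ fun h' => h ⟨rfl, h'⟩]
      · rw [hφ.opF_mul_opF_of_ne _ _ _ _ hac, Matrix.trace_zero]
  · intro α β a b c e h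
    rw [opF_conjTranspose, hφ.opF_mul_opF_of_shape_ne h, Matrix.trace_zero]
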